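/- **Setting.** Let $d\ge 0$ be an integer, $I=\{+,z,-\}$, with the involution $\bar{\ }:(+,z,-)\mapsto(-,z,+)$, and let $\tilde\epsilon_{ijk}$ $(i,j,k\in I)$ be given by $\tilde\epsilon_{\pm\mp z}=\pm1$, $\tilde\epsilon_{\pm z\pm}=\mp1$, $\tilde\epsilon_{z\pm\pm}=\pm1$ and $\tilde\epsilon_{ijk}=0$ otherwise. To each multi-index $\alpha\in\mathbb N^{I\times\mathbb Z^d}$ with $|\alpha|=\sum_{x,i}\alpha_i(x)<\infty$ let there be given $V(\alpha)\in\mathbb C$ such that $\overline{V(\alpha)}=V(\bar\alpha)$, where $\bar\alpha_i(x)=\alpha_{\bar i}(x)$, and $$\|V\|=\sum_{n\in\mathbb N}\ \sup_{x\in\mathbb Z^d}\ \sum_{|\alpha|=n}|\alpha(x)|\,|V(\alpha)|\,e^n<\infty,\qquad |\alpha(x)|=\sum_{i\in I}\alpha_i(x).$$ *Classical system.* Let $\Xi=\prod_{x\in\mathbb Z^d}\overline{B_1(0)}$, $\overline{B_1(0)}\subset\mathbb R^3$ the closed unit ball, with the product topology; $M_\pm(x)=(M_1(x)\pm iM_2(x))/\sqrt2$,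 $M_z(x)=M_3(x)$; let $\mathfrak A=C(\Xi;\mathbb C)$ with $\|\cdot\|_\infty$, and $\mathfrak P=\mathbb C[\{M_i(x):i\in I,x\in\mathbb Z^d\}]$. For $\Lambda\subset\mathbb Z^d$ let $\phi^t_\Lambda$ be the flow on $\Xi$ of $$\frac{d}{dt}M_i(t,x)=\sum_{\alpha\in\mathbb N^{I\times\Lambda}}V(\alpha)\sum_{j,k\in I}i\,\tilde\epsilon_{jik}\,\alpha_j(x)\,M^{\alpha-\delta_j(x)+\delta_k(x)}(t)$$ (so that spins outside $\Lambda$ do not move). The infinite-volume dynamics $(\alpha^t)_{t\in\mathbb R}$ is the strongly continuous one-parameter group of $*$-automorphisms of $\mathfrak A$ with $\alpha^tA=\lim_{\Lambda\to\infty}A\circ\phi^t_\Lambda$ uniformly for each $A$ depending on finitely many spins (the limit is over finite $\Lambda$ eventually containing every finite set), and $\alpha^tA=A\circ\phi^t_{\mathbb Z^d}$ for all $A\in\mathfrak A$. *Quantum system.* For $s\in\{\tfrac12,1,\tfrac32,\dots\}$ let $\widehat{\mathfrak A}_\Lambda$ be the algebra of operators on $\bigotimes_{x\in\Lambda}\mathbb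 C^{2s+1}$ for finite $\Lambda$, with $\widehat{\mathfrak A}_{\Lambda_1}\subset\widehat{\mathfrak A}_{\Lambda_2}$ for $\Lambda_1\subset\Lambda_2$ via $\mathcal A\mapsto\mathcal A\otimes 1$, and let $\widehat{\mathfrak A}$ be the quasi-local $C^*$-algebra, i.e. the norm closure of $\bigcup_\Lambda\widehat{\mathfrak A}_\Lambda$. Let $\widehat S_1(x),\widehat S_2(x),\widehat S_3(x)$ be $s^{-1}$ times the generators of the spin-$s$ representation of $su(2)$ at the site $x$, $\widehat S_\pm(x)=(\widehat S_1(x)\pm i\widehat S_2(x))/\sqrt2$ and $\widehat S_z(x)=\widehat S_3(x)$. Quantization $A\mapsto\widehat A$ is the linear map $\mathfrak P\to\widehat{\mathfrak A}$ that replaces each $M_i(x)$ in a monomial by $\widehat S_i(x)$ and orders the factors so that all $\widehat S_+$ stand to the left of all $\widehat S_z$ and these to the left of all $\widehat S_-$. Put $\widehat H_\Lambda=\sum_{\alpha\in\mathbb N^{I\times\Lambda}}V(\alpha)\,\widehat{M^\alpha}$. The infinite-volume dynamics $(\widehat\alpha^t)_{t\in\mathbb R}$ is the strongly continuous one-parameter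 group of $*$-automorphisms of $\widehat{\mathfrak A}$ with $\widehat\alpha^t\mathcal A=\lim_{\Lambda\to\infty}e^{is\widehat H_\Lambda t}\mathcal A\,e^{-is\widehat H_\Lambda t}$ in norm for each local $\mathcal A$. **Theorem.** The dynamics $\alpha^t$ and, for every $s$, $\widehat\alpha^t$ exist and are unique. For every $A\in\mathfrak P$ and $\epsilon>0$ there is a family $A(t)\in\mathfrak P$, $t\in\mathbb R$, not depending on $s$, such that $$\sup_{t\in\mathbb R}\|\alpha^tA-A(t)\|_\infty\le\epsilon,$$ and, for every $t\in\mathbb R$, there is a constant $C(\epsilon,t,A)$ not depending on $s$ such that for all $s\in\{\tfrac12,1,\tfrac32,\dots\}$ $$\big\|\widehat\alpha^t\widehat A-\widehat{A(t)}\big\|\le\epsilon+\frac{C(\epsilon,t,A)}{s}.$$ -/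

import Mathlib

open Filter Topology
open scoped ENNReal

namespace SpinSystem

/-! ### Lattice, multi-indices, potentials -/

/-- The lattice `ℤ^d`. -/
abbrev Site (d : ℕ) : Type := Fin d → ℤ

/-- The index set `I = {+, z, -}`. -/
inductive Idx : Type
  | plus
  | z
  | minus
  deriving DecidableEq

instance : Fintype Idx := ⟨{.plus, .z, .minus}, fun i => by cases i <;> decide⟩

/-- The involution `(+, z, -) ↦ (-, z, +)` of `I`. -/
def Idx.bar : Idx → Idx
  | .plus => .minus
  | .z => .z
  | .minus => .plus

/-- The structure constants `ε̃ i j k`. -/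
def eps : Idx → Idx → Idx → ℤ
  | .plus, .minus, .z => 1
  | .minus, .plus, .z => -1
  | .plus, .z, .plus => -1
  | .minus, .z, .minus => 1
  | .z, .plus, .plus => 1
  | .z, .minus, .minus => -1
  | _, _, _ => 0

/-- Multi-indices `α ∈ ℕ^{I × ℤ^d}` with `|α| < ∞`; `|α|` is `Finsupp.degree α`. -/
abbrev MultiIndex (d : ℕ) : Type := (Site d × Idx) →₀ ℕ

/-- The conjugate multi-index, `ᾱ_i(x) = α_{ī}(x)`. -/
noncomputable def MultiIndex.bar {d : ℕ} (α : MultiIndex d) : MultiIndex d :=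
  α.mapDomain (fun p => (p.1, p.2.bar))

/-- `|α(x)| = ∑_i α_i(x)`. -/
def MultiIndex.at {d : ℕ} (α : MultiIndex d) (x : Site d) : ℕ :=
  ∑ i : Idx, α (x, i)

/-- An interaction potential: a complex number `V(α)` for every multi-index. -/
abbrev Potential (d : ℕ) : Type := MultiIndex d → ℂ

/-- The reality condition `conj V(α) = V(ᾱ)`. -/
def Potential.IsReal {d : ℕ} (V : Potential d) : Prop :=
  ∀ α : MultiIndex d, (starRingEnd ℂ) (V α) = V α.bar

/-- `‖V‖ = ∑_n sup_x ∑_{|α| = n} |α(x)| |V(α)| e^n`, with values in `[0, ∞]`. -/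
noncomputable def Potential.norm {d : ℕ} (V : Potential d) : ℝ≥0∞ :=
  ∑' n : ℕ, ⨆ x : Site d, ∑' α : {α : MultiIndex d // α.degree = n},
    (α.1.at x : ℝ≥0∞) * ‖V α.1‖ₑ * ENNReal.ofReal (Real.exp n)

open Classical in
/-- The part of the potential living on the region `Λ`: only multi-indices in `ℕ^{I × Λ}`
are kept. -/
noncomputable def Potential.restrict {d : ℕ} (V : Potential d) (Λ : Finset (Site d)) :
    Potential d :=
  fun α => if ∀ p ∈ α.support, p.1 ∈ Λ then V α else 0

/-! ### Classical spins -/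

/-- The closed unit ball of `ℝ³`. -/
abbrev Ball3 : Type := Metric.closedBall (0 : EuclideanSpace ℝ (Fin 3)) 1

/-- The phase space `Ξ = ∏_{x ∈ ℤ^d} (closed unit ball)`, with the product topology. -/
abbrev Phase (d : ℕ) : Type := Site d → Ball3

/-- The complex coordinates `M_± = (M₁ ± i M₂)/√2` and `M_z = M₃`. -/
noncomputable def coord : Idx → Ball3 → ℂ
  | .plus, m => ((m.1 0 : ℂ) + Complex.I * (m.1 1 : ℂ)) / (Real.sqrt 2 : ℂ)
  | .z, m => (m.1 2 : ℂ)
  | .minus, m => ((m.1 0 : ℂ) - Complex.I * (m.1 1 : ℂ)) / (Real.sqrt 2 : ℂ)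

theorem continuous_coord (i : Idx) : Continuous (coord i) := by
  cases i <;> unfold coord <;> fun_prop

/-- The classical quasi-local algebra `𝔄`, i.e. the continuous complex functions on `Ξ`
with the supremum norm. -/
abbrev ClassicalAlg (d : ℕ) : Type := C(Phase d, ℂ)

/-- The function `M_i(x) ∈ 𝔄`. -/
noncomputable def classicalSpin {d : ℕ} (p : Site d × Idx) : ClassicalAlg d :=
  ⟨fun M => coord p.2 (M p.1), (continuous_coord p.2).comp (continuous_apply p.1)⟩

/-- The algebra `𝔓 = ℂ[{M_i(x)}]`. -/
abbrev Poly (d : ℕ) : Type := MvPolynomial (Site d × Idx) ℂ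

/-- A polynomial viewed as an element of `𝔄`. -/
noncomputable def Poly.toFun {d : ℕ} : Poly d →ₐ[ℂ] ClassicalAlg d :=
  MvPolynomial.aeval classicalSpin

/-- The monomial `M^α`, evaluated at a spin configuration. -/
noncomputable def monomialAt {d : ℕ} (α : MultiIndex d) (M : Phase d) : ℂ :=
  α.prod fun p e => coord p.2 (M p.1) ^ e

/-- The right-hand side of the Hamiltonian equation of motion for `M_i(x)`:
`∑_α V(α) ∑_{j,k} i ε̃_{jik} α_j(x) M^{α - δ_j(x) + δ_k(x)}`. -/
noncomputable def vectorField {d : ℕ} (V : Potential d) (M : Phase d) (x : Site d) (i : Idx) : ℂ :=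
  ∑' α : MultiIndex d, V α * ∑ j : Idx, ∑ k : Idx,
    Complex.I * (eps j i k : ℂ) * (α (x, j) : ℂ) *
      monomialAt (α - Finsupp.single (x, j) 1 + Finsupp.single (x, k) 1) M

/-- `φ` is the Hamiltonian (Landau-Lifschitz) flow of the potential `V` on `Ξ`: for every initial
configuration `M₀`, the curve `t ↦ φ t M₀` is a global solution of the equation of motion that
starts at `M₀`. For the potential `V.restrict Λ` the spins in `Λ` follow the flow of the
Hamiltonian `H_Λ` and the spins outside of `Λ` do not move. -/
def IsFlow {d : ℕ} (V : Potential d) (φ : ℝ → Phase d → Phase d) : Prop :=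
  ∀ M₀ : Phase d, φ 0 M₀ = M₀ ∧
    ∀ (t : ℝ) (x : Site d) (i : Idx),
      HasDerivAt (fun τ : ℝ => coord i (φ τ M₀ x)) (vectorField V (φ t M₀) x i) t

/-- `α` is the infinite-volume dynamics on `𝔄`: a strongly continuous one-parameter group of
automorphisms that on local functions `A` is the uniform limit, as `Λ → ℤ^d`, of the
finite-volume dynamics `A ↦ A ∘ φ_Λ^t`, and that is given by the Landau-Lifschitz flow on the
whole lattice. -/
structure IsClassicalDynamics {d : ℕ} (V : Potential d)
    (α : ℝ → ClassicalAlg d ≃⋆ₐ[ℂ] ClassicalAlg d) : Prop where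
  zero : ∀ A, α 0 A = A
  add : ∀ t u A, α (t + u) A = α t (α u A)
  continuous : ∀ A, Continuous fun t => α t A
  limit : ∃ φ : Finset (Site d) → ℝ → Phase d → Phase d,
    (∀ Λ, IsFlow (V.restrict Λ) (φ Λ)) ∧
    ∀ (Λ₀ : Finset (Site d)) (A : ClassicalAlg d), DependsOn A (Λ₀ : Set (Site d)) →
      ∀ t : ℝ, TendstoUniformly (fun Λ M => A (φ Λ t M)) (α t A) atTop
  flow : ∃ φ : ℝ → Phase d → Phase d, IsFlow V φ ∧ ∀ t A M, α t A M = A (φ t M)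

/-! ### Quantum spins

The spin is `s = n / 2` with `n : ℕ`, and `ℂ^{2s+1}` has the orthonormal basis indexed by
`Fin (n + 1)`, the index `k` standing for the weight `s - k`. -/

/-- The spin operators of the spin-`n/2` representation of `su(2)`, rescaled by `1/s`:
`S_z = diag((s - k)/s)`, and `S_± = (S₁ ± i S₂)/√2`, i.e. `J_±/(√2 s)` with the standard ladder
operators `J_+ e_{k+1} = √((k+1)(2s-k)) e_k` and `J_- = J_+^*`. -/
noncomputable def spinMatrix (n : ℕ) : Idx → Matrix (Fin (n + 1)) (Fin (n + 1)) ℂ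
  | .plus => fun k l =>
      if (l : ℕ) = k + 1 then
        ((Real.sqrt (((k : ℝ) + 1) * ((n : ℝ) - k)) / (Real.sqrt 2 * ((n : ℝ) / 2)) : ℝ) : ℂ)
      else 0
  | .z => fun k l => if k = l then ((((n : ℝ) / 2 - k) / ((n : ℝ) / 2) : ℝ) : ℂ) else 0
  | .minus => fun k l =>
      if (k : ℕ) = l + 1 then
        ((Real.sqrt (((l : ℝ) + 1) * ((n : ℝ) - l)) / (Real.sqrt 2 * ((n : ℝ) / 2)) : ℝ) : ℂ)
      else 0

/-- Product-basis labels of the lattice spin system. -/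
abbrev Config (d n : ℕ) : Type := Site d → Fin (n + 1)

/-- The Hilbert space `ℓ²(Config)` on which all local operators act faithfully: for each finite
`Λ` it is `(⨂_{x ∈ Λ} ℂ^{2s+1}) ⊗ ℓ²(configurations outside of Λ)`. -/
abbrev Hilb (d n : ℕ) : Type := lp (fun _ : Config d n => ℂ) 2

/-- The coefficients of `(a at site x, identity at all other sites) ψ`. -/
noncomputable def siteCoeff {d n : ℕ} (x : Site d) (a : Matrix (Fin (n + 1)) (Fin (n + 1)) ℂ)
    (ψ : Config d n → ℂ) (η : Config d n) : ℂ :=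
  ∑ k, a (η x) k * ψ (Function.update η x k)

theorem hilb_summable {d n : ℕ} (ψ : Hilb d n) : Summable fun η => ‖ψ η‖ ^ 2 := by
  simpa using (lp.memℓp ψ).summable (by norm_num)

theorem hilb_norm_sq {d n : ℕ} (ψ : Hilb d n) : ‖ψ‖ ^ 2 = ∑' η, ‖ψ η‖ ^ 2 := by
  simpa using lp.norm_rpow_eq_tsum (p := 2) (by norm_num) ψ

/-- The permutation of configurations that applies `π` at the site `x`. -/
def sitePerm {d n : ℕ} (x : Site d) (π : Equiv.Perm (Fin (n + 1))) : Equiv.Perm (Config d n) :=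
  Equiv.piCongrRight fun y => if y = x then π else Equiv.refl _

theorem sitePerm_swap {d n : ℕ} (x : Site d) (η : Config d n) (k : Fin (n + 1)) :
    sitePerm x (Equiv.swap (η x) k) η = Function.update η x k := by
  funext y
  by_cases h : y = x
  · subst h; simp [sitePerm]
  · simp [sitePerm, h]

theorem siteCoeff_bound {d n : ℕ} (x : Site d) (a : Matrix (Fin (n + 1)) (Fin (n + 1)) ℂ)
    (ψ : Config d n → ℂ) (η : Config d n) :
    ‖siteCoeff x a ψ η‖ ^ 2 ≤
      (∑ j, ∑ k, ‖a j k‖ ^ 2) * ∑ k, ∑ j, ‖ψ (sitePerm x (Equiv.swap j k) η)‖ ^ 2 := by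
  have h1 : ‖siteCoeff x a ψ η‖ ^ 2 ≤ (∑ k, ‖a (η x) k‖ * ‖ψ (Function.update η x k)‖) ^ 2 := by
    gcongr
    refine (norm_sum_le _ _).trans (le_of_eq ?_)
    simp
  refine h1.trans ((Finset.sum_mul_sq_le_sq_mul_sq _ _ _).trans ?_)
  refine mul_le_mul ?_ (Finset.sum_le_sum fun k _ => ?_) (by positivity) (by positivity)
  · exact Finset.single_le_sum (f := fun j => ∑ k, ‖a j k‖ ^ 2)
      (fun j _ => by positivity) (Finset.mem_univ (η x))
  · rw [← sitePerm_swap x η k]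
    exact Finset.single_le_sum (f := fun j => ‖ψ (sitePerm x (Equiv.swap j k) η)‖ ^ 2)
      (fun j _ => by positivity) (Finset.mem_univ (η x))

theorem siteCoeff_hasSum {d n : ℕ} (x : Site d) (ψ : Hilb d n) :
    HasSum (fun η => ∑ k : Fin (n + 1), ∑ j, ‖ψ (sitePerm x (Equiv.swap j k) η)‖ ^ 2)
      (((n : ℝ) + 1) ^ 2 * ‖ψ‖ ^ 2) := by
  have h : ∀ j k : Fin (n + 1),
      HasSum (fun η => ‖ψ (sitePerm x (Equiv.swap j k) η)‖ ^ 2) (‖ψ‖ ^ 2) := by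
    intro j k
    have := (hilb_summable ψ).hasSum
    rw [← hilb_norm_sq] at this
    exact (Equiv.hasSum_iff (sitePerm x (Equiv.swap j k))).2 this
  have := hasSum_sum (s := Finset.univ) fun k _ => hasSum_sum (s := Finset.univ) fun j _ => h j k
  convert this using 1
  simp
  ring

theorem siteCoeff_memℓp {d n : ℕ} (x : Site d) (a : Matrix (Fin (n + 1)) (Fin (n + 1)) ℂ)
    (ψ : Hilb d n) : Memℓp (siteCoeff x a ψ) 2 := by
  refine memℓp_gen ?_
  have := ((siteCoeff_hasSum x ψ).summable.mul_left (∑ j, ∑ k, ‖a j k‖ ^ 2))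
  simpa using Summable.of_nonneg_of_le (fun η => by positivity) (siteCoeff_bound x a ψ) this

/-- The operator on `Hilb` acting as `a` at the site `x` and as the identity at all other
sites. -/
noncomputable def siteOp {d n : ℕ} (x : Site d) (a : Matrix (Fin (n + 1)) (Fin (n + 1)) ℂ) :
    Hilb d n →L[ℂ] Hilb d n :=
  LinearMap.mkContinuous
    { toFun := fun ψ => ⟨siteCoeff x a ψ, siteCoeff_memℓp x a ψ⟩
      map_add' := fun ψ χ => by
        ext η
        change siteCoeff x a (ψ + χ) η = siteCoeff x a ψ η + siteCoeff x a χ η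
        simp [siteCoeff, mul_add, Finset.sum_add_distrib]
      map_smul' := fun c ψ => by
        ext η
        simp [siteCoeff, Finset.mul_sum, mul_left_comm] }
    (Real.sqrt ((∑ j, ∑ k, ‖a j k‖ ^ 2) * ((n : ℝ) + 1) ^ 2))
    (fun ψ => by
      refine le_of_sq_le_sq ?_ (by positivity)
      rw [hilb_norm_sq, mul_pow, Real.sq_sqrt (by positivity), mul_assoc]
      have h := (siteCoeff_hasSum x ψ).mul_left (∑ j, ∑ k, ‖a j k‖ ^ 2)
      rw [← h.tsum_eq]
      exact Summable.tsum_le_tsum (siteCoeff_bound x a ψ)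
        (Summable.of_nonneg_of_le (fun η => by positivity) (siteCoeff_bound x a ψ) h.summable)
        h.summable)

/-- The local algebra `𝔄̂_Λ` of all operators on `⨂_{x ∈ Λ} ℂ^{2s+1}`, acting on `Hilb` as
`𝒜 ⊗ 1`; it is generated by the operators that act at one site of `Λ`. -/
noncomputable def localAlg (d n : ℕ) (Λ : Finset (Site d)) :
    StarSubalgebra ℂ (Hilb d n →L[ℂ] Hilb d n) :=
  StarAlgebra.adjoin ℂ {T | ∃ x ∈ Λ, ∃ a, T = siteOp x a}

/-- The quantum quasi-local algebra `𝔄̂`, the norm closure of the algebra generated by all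
`𝔄̂_Λ` with `Λ` finite. -/
noncomputable def quasiLocal (d n : ℕ) : StarSubalgebra ℂ (Hilb d n →L[ℂ] Hilb d n) :=
  (⨆ Λ : Finset (Site d), localAlg d n Λ).topologicalClosure

/-- The C*-algebra `𝔄̂` as a type. -/
abbrev QuantumAlg (d n : ℕ) : Type := quasiLocal d n

theorem localAlg_le {d n : ℕ} (Λ : Finset (Site d)) : localAlg d n Λ ≤ quasiLocal d n :=
  (le_iSup (fun Λ => localAlg d n Λ) Λ).trans (StarSubalgebra.le_topologicalClosure _)

/-- The spin operator `Ŝ_i(x) ∈ 𝔄̂`. -/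
noncomputable def quantumSpin {d : ℕ} (n : ℕ) (p : Site d × Idx) : QuantumAlg d n :=
  ⟨siteOp p.1 (spinMatrix n p.2),
    localAlg_le {p.1} (StarAlgebra.subset_adjoin ℂ _ ⟨p.1, by simp, _, rfl⟩)⟩

/-- The product `∏_x Ŝ_i(x)^{α_i(x)}` for fixed `i`. The factors commute, so the order of the
sites is irrelevant. -/
noncomputable def spinPower {d : ℕ} (n : ℕ) (i : Idx) (α : MultiIndex d) : QuantumAlg d n :=
  ((α.support.image Prod.fst).toList.map fun x => quantumSpin n (x, i) ^ α (x, i)).prod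

/-- The normal-ordered quantization of the monomial `M^α`: all `Ŝ_+` stand to the left of all
`Ŝ_z`, which stand to the left of all `Ŝ_-`. -/
noncomputable def quantizeMonomial {d : ℕ} (n : ℕ) (α : MultiIndex d) : QuantumAlg d n :=
  spinPower n .plus α * spinPower n .z α * spinPower n .minus α

/-- Quantization `𝔓 → 𝔄̂`, the linear extension of `quantizeMonomial`. -/
noncomputable def quantize {d : ℕ} (n : ℕ) (A : Poly d) : QuantumAlg d n :=
  ∑ α ∈ A.support, A.coeff α • quantizeMonomial n α

/-- The Hamiltonian `Ĥ_Λ`, the term by term quantization of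
`H_Λ = ∑_{α ∈ ℕ^{I × Λ}} V(α) M^α`. -/
noncomputable def hamiltonian {d : ℕ} (V : Potential d) (n : ℕ) (Λ : Finset (Site d)) :
    QuantumAlg d n :=
  ∑' α : MultiIndex d, V.restrict Λ α • quantizeMonomial n α

/-- The propagator `U_s(t; Ĥ_Λ) = exp(-i s t Ĥ_Λ)` with `s = n / 2`. -/
noncomputable def propagator {d : ℕ} (V : Potential d) (n : ℕ) (Λ : Finset (Site d)) (t : ℝ) :
    QuantumAlg d n :=
  NormedSpace.exp ((-(Complex.I * ((n : ℂ) / 2) * (t : ℂ))) • hamiltonian V n Λ)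

/-- `α` is the infinite-volume dynamics on `𝔄̂` for spin `s = n / 2`: a strongly continuous
one-parameter group of automorphisms that on each local algebra is the norm limit, as
`Λ → ℤ^d`, of the finite-volume dynamics `𝒜 ↦ U_s(t; Ĥ_Λ)^* 𝒜 U_s(t; Ĥ_Λ)`. -/
structure IsQuantumDynamics {d : ℕ} (V : Potential d) (n : ℕ)
    (α : ℝ → QuantumAlg d n ≃⋆ₐ[ℂ] QuantumAlg d n) : Prop where
  zero : ∀ a, α 0 a = a
  add : ∀ t u a, α (t + u) a = α t (α u a)
  continuous : ∀ a, Continuous fun t => α t a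
  limit : ∀ (Λ₀ : Finset (Site d)) (a : QuantumAlg d n),
    (a : Hilb d n →L[ℂ] Hilb d n) ∈ localAlg d n Λ₀ →
      ∀ t : ℝ, Tendsto (fun Λ => star (propagator V n Λ t) * a * propagator V n Λ t) atTop
        (𝓝 (α t a))

end SpinSystem

/-!
Regard the symbols `M_i(x)` as letters of a free algebra, on which the bracket with a monomial
`M^α` is defined by the Leibniz rule. For the classical spins and for the rescaled spin operators,
in every volume, the values of words solve the same equation of motion
`d/dt ⟨w⟩ = ∑_α V(α) ⟨{M^α, w}⟩`: the factor `s` of the generator cancels the factor `1 / s` of the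
commutators. With respect to the norms `∑_w |B_w| e^{r |w|}` the derivation on the right loses only
a factor `K / h` when `r` decreases by `h`, so for short times, uniformly in all solutions, a Taylor
polynomial built from finitely many monomials `M^α` approximates the evolution of a polynomial `A`.
The time step does not depend on `A`, so iteration yields for every `t` and `ε` a polynomial `B`
such that `A` at time `t` is `ε`-close to `B` at time `0` for all solutions at once. The
thermodynamic limits, the uniqueness, and the classical limit follow from this; in the last one,
normal ordering of `B` costs a term of order `1 / s`.
-/

namespace SpinSystem

/-! ### The free algebra on an alphabet -/

section Words

variable {L : Type*}

/-- The monomial of the free algebra that is spelled by the list `w`. -/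
noncomputable def word (w : List L) : FreeAlgebra ℂ L := (w.map (FreeAlgebra.ι ℂ)).prod

@[simp] theorem word_nil : word ([] : List L) = 1 := rfl

theorem word_cons (a : L) (w : List L) : word (a :: w) = FreeAlgebra.ι ℂ a * word w := by
  simp [word]

theorem word_append (u w : List L) : word (u ++ w) = word u * word w := by
  simp [word]

theorem word_singleton (a : L) : word [a] = FreeAlgebra.ι ℂ a := by
  simp [word]

theorem lift_word {𝔅 : Type*} [Ring 𝔅] [Algebra ℂ 𝔅] (s : L → 𝔅) (w : List L) :
    FreeAlgebra.lift ℂ s (word w) = (w.map s).prod := by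
  simp [word, map_list_prod, Function.comp_def]

/-- The basis of the free algebra consisting of the words. -/
noncomputable def wordBasis (L : Type*) : Module.Basis (List L) ℂ (FreeAlgebra ℂ L) :=
  (FreeAlgebra.basisFreeMonoid ℂ L).reindex FreeMonoid.toList

theorem wordBasis_apply (w : List L) : wordBasis L w = word w := by
  have h : wordBasis L w =
      MonoidAlgebra.lift ℂ (FreeAlgebra ℂ L) (FreeMonoid L) (FreeMonoid.lift (FreeAlgebra.ι ℂ))
        (MonoidAlgebra.single (FreeMonoid.ofList w) 1) := by
    simp [wordBasis, FreeAlgebra.basisFreeMonoid, FreeAlgebra.equivMonoidAlgebraFreeMonoid]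
  rw [h, MonoidAlgebra.lift_single, one_smul, FreeMonoid.lift_apply]
  rfl

theorem sum_repr_smul_word (B : FreeAlgebra ℂ L) :
    ∑ w ∈ ((wordBasis L).repr B).support, (wordBasis L).repr B w • word w = B := by
  simpa only [Finsupp.linearCombination_apply, Finsupp.sum, wordBasis_apply] using
    (wordBasis L).linearCombination_repr B

/-- The weighted `ℓ¹`-norm `∑_w |B_w| e^{r |w|}` of `B = ∑_w B_w w`. -/
noncomputable def wnorm (r : ℝ) : Seminorm ℂ (FreeAlgebra ℂ L) :=
  Seminorm.of
    (fun B => ((wordBasis L).repr B).sum fun w c => ‖c‖ * Real.exp (r * w.length))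
    (fun B C => by
      classical
      simp only [map_add]
      set b := (wordBasis L).repr B
      set c := (wordBasis L).repr C
      rw [Finsupp.sum_of_support_subset (b + c) Finsupp.support_add _ (by simp),
        Finsupp.sum_of_support_subset b Finset.subset_union_left _ (by simp),
        Finsupp.sum_of_support_subset c Finset.subset_union_right _ (by simp),
        ← Finset.sum_add_distrib]
      gcongr with w
      rw [← add_mul]
      gcongr
      exact norm_add_le _ _)
    (fun z B => by
      rw [map_smul, Finsupp.sum_smul_index' (by simp), Finsupp.mul_sum]
      simp only [norm_smul, mul_assoc])

theorem wnorm_apply (r : ℝ) (B : FreeAlgebra ℂ L) :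
    wnorm r B = ∑ w ∈ ((wordBasis L).repr B).support,
      ‖(wordBasis L).repr B w‖ * Real.exp (r * w.length) := rfl

theorem wnorm_word (r : ℝ) (w : List L) : wnorm r (word w) = Real.exp (r * w.length) := by
  simp [wnorm_apply, ← wordBasis_apply, Module.Basis.repr_self]

/-- `wnorm r` is the largest seminorm with these values on words, hence estimates need to be
checked on words only. -/
theorem seminorm_le_mul_wnorm {p : Seminorm ℂ (FreeAlgebra ℂ L)} {r C : ℝ}
    (hp : ∀ w, p (word w) ≤ C * Real.exp (r * w.length)) (B : FreeAlgebra ℂ L) :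
    p B ≤ C * wnorm r B := by
  conv_lhs => rw [← sum_repr_smul_word B]
  refine (Finset.le_sum_of_subadditive p (map_zero p).le (map_add_le_add p) _ _).trans ?_
  rw [wnorm_apply, Finset.mul_sum]
  gcongr with w
  rw [map_smul_eq_mul, mul_left_comm]
  gcongr
  exact hp w

theorem wnorm_mul_le (r : ℝ) (B C : FreeAlgebra ℂ L) :
    wnorm r (B * C) ≤ wnorm r B * wnorm r C := by
  have word_mul_le (w : List L) :
      wnorm r (word w * C) ≤ Real.exp (r * w.length) * wnorm r C := by
    refine seminorm_le_mul_wnorm (p := (wnorm r).comp (LinearMap.mulLeft ℂ (word w)))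
      (fun v => le_of_eq ?_) C
    rw [Seminorm.comp_apply, LinearMap.mulLeft_apply, ← word_append, wnorm_word, ← Real.exp_add,
      List.length_append, Nat.cast_add, mul_add]
  rw [mul_comm (wnorm r B)]
  refine seminorm_le_mul_wnorm (p := (wnorm r).comp (LinearMap.mulRight ℂ C)) (fun w => ?_) B
  rw [mul_comm (wnorm r C)]
  exact word_mul_le w

theorem norm_le_mul_wnorm {E : Type*} [SeminormedAddCommGroup E] [NormedSpace ℂ E]
    {f : FreeAlgebra ℂ L →ₗ[ℂ] E} {r C : ℝ}
    (hf : ∀ w, ‖f (word w)‖ ≤ C * Real.exp (r * w.length)) (B : FreeAlgebra ℂ L) :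
    ‖f B‖ ≤ C * wnorm r B :=
  seminorm_le_mul_wnorm (p := (normSeminorm ℂ E).comp f) hf B

theorem norm_lift_word_le {𝔅 : Type*} [NormedRing 𝔅] [NormOneClass 𝔅] [NormedAlgebra ℂ 𝔅]
    {s : L → 𝔅} {c : ℝ} (hs : ∀ a, ‖s a‖ ≤ c) (w : List L) :
    ‖FreeAlgebra.lift ℂ s (word w)‖ ≤ c ^ w.length := by
  induction w with
  | nil => simp
  | cons a w ih =>
    rw [word_cons, map_mul, FreeAlgebra.lift_ι_apply, List.length_cons, pow_succ']
    exact norm_mul_le_of_le (hs a) ih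

/-! ### Brackets on the free algebra -/

/-- The bracket `{u, b}` of a word `u` with a letter `b`, defined by the Leibniz rule from the
brackets `β a b` of letters. -/
noncomputable def leibnizLeft (β : L → L → FreeAlgebra ℂ L) : List L → L → FreeAlgebra ℂ L
  | [], _ => 0
  | a :: u, b => β a b * word u + FreeAlgebra.ι ℂ a * leibnizLeft β u b

/-- The bracket `{u, w}` of two words, defined by the Leibniz rule from the brackets `β a b` of
letters. -/
noncomputable def leibniz (β : L → L → FreeAlgebra ℂ L) (u : List L) :
    List L → FreeAlgebra ℂ L
  | [] => 0
  | b :: w => leibnizLeft β u b * word w + FreeAlgebra.ι ℂ b * leibniz β u w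

/-- The bracket `{u, ·}` with a word `u`, as a linear map. -/
noncomputable def bracket (β : L → L → FreeAlgebra ℂ L) (u : List L) :
    FreeAlgebra ℂ L →ₗ[ℂ] FreeAlgebra ℂ L :=
  (wordBasis L).constr ℂ (leibniz β u)

theorem bracket_word (β : L → L → FreeAlgebra ℂ L) (u w : List L) :
    bracket β u (word w) = leibniz β u w := by
  rw [bracket, ← wordBasis_apply, Module.Basis.constr_basis]

section Commutator

variable {𝔅 : Type*} [Ring 𝔅] [Algebra ℂ 𝔅] {s : L → 𝔅} {β : L → L → FreeAlgebra ℂ L} {c : ℂ}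

theorem commutator_lift_word_letter
    (hs : ∀ a b, s a * s b - s b * s a = c • FreeAlgebra.lift ℂ s (β a b)) (u : List L) (b : L) :
    FreeAlgebra.lift ℂ s (word u) * s b - s b * FreeAlgebra.lift ℂ s (word u) =
      c • FreeAlgebra.lift ℂ s (leibnizLeft β u b) := by
  induction u with
  | nil => simp [leibnizLeft]
  | cons a u ih =>
    simp only [word_cons, leibnizLeft, map_add, map_mul, FreeAlgebra.lift_ι_apply, smul_add]
    rw [← smul_mul_assoc, ← hs a b, ← mul_smul_comm, ← ih]
    noncomm_ring

theorem commutator_lift_word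
    (hs : ∀ a b, s a * s b - s b * s a = c • FreeAlgebra.lift ℂ s (β a b)) (u w : List L) :
    FreeAlgebra.lift ℂ s (word u) * FreeAlgebra.lift ℂ s (word w) -
        FreeAlgebra.lift ℂ s (word w) * FreeAlgebra.lift ℂ s (word u) =
      c • FreeAlgebra.lift ℂ s (leibniz β u w) := by
  induction w with
  | nil => simp [leibniz]
  | cons b w ih =>
    simp only [word_cons, leibniz, map_add, map_mul, FreeAlgebra.lift_ι_apply, smul_add]
    rw [← smul_mul_assoc, ← commutator_lift_word_letter hs u b, ← mul_smul_comm, ← ih]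
    noncomm_ring

theorem commutator_lift
    (hs : ∀ a b, s a * s b - s b * s a = c • FreeAlgebra.lift ℂ s (β a b)) (u : List L)
    (B : FreeAlgebra ℂ L) :
    FreeAlgebra.lift ℂ s (word u) * FreeAlgebra.lift ℂ s B -
        FreeAlgebra.lift ℂ s B * FreeAlgebra.lift ℂ s (word u) =
      c • FreeAlgebra.lift ℂ s (bracket β u B) := by
  have hext : (LinearMap.mulLeft ℂ (FreeAlgebra.lift ℂ s (word u)) -
        LinearMap.mulRight ℂ (FreeAlgebra.lift ℂ s (word u))) ∘ₗ
          (FreeAlgebra.lift ℂ s).toLinearMap =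
      c • (FreeAlgebra.lift ℂ s).toLinearMap ∘ₗ bracket β u := by
    refine (wordBasis L).ext fun w => ?_
    simpa [wordBasis_apply, bracket_word] using commutator_lift_word hs u w
  exact DFunLike.congr_fun hext B

end Commutator

section BracketNorm

variable {β : L → L → FreeAlgebra ℂ L} {κ : L → L → ℝ} {r : ℝ}

theorem wnorm_leibnizLeft_le (hβ : ∀ a b, wnorm r (β a b) ≤ κ a b * Real.exp r)
    (u : List L) (b : L) :
    wnorm r (leibnizLeft β u b) ≤ (u.map (κ · b)).sum * Real.exp (r * u.length) := by
  induction u with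
  | nil => simp [leibnizLeft]
  | cons a u ih =>
    have hexp : Real.exp (r * (a :: u).length) = Real.exp r * Real.exp (r * u.length) := by
      rw [← Real.exp_add]; push_cast [List.length_cons]; ring_nf
    calc wnorm r (leibnizLeft β (a :: u) b)
        ≤ wnorm r (β a b) * wnorm r (word u) +
          wnorm r (FreeAlgebra.ι ℂ a) * wnorm r (leibnizLeft β u b) :=
          (map_add_le_add _ _ _).trans (add_le_add (wnorm_mul_le _ _ _) (wnorm_mul_le _ _ _))
      _ ≤ κ a b * Real.exp r * Real.exp (r * u.length) +
          Real.exp r * ((u.map (κ · b)).sum * Real.exp (r * u.length)) := by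
          rw [← word_singleton, wnorm_word, wnorm_word, List.length_singleton, Nat.cast_one,
            mul_one]
          gcongr
          exact hβ a b
      _ = ((a :: u).map (κ · b)).sum * Real.exp (r * (a :: u).length) := by
          rw [hexp, List.map_cons, List.sum_cons]; ring

theorem wnorm_leibniz_le (hr : 0 ≤ r) (hβ : ∀ a b, wnorm r (β a b) ≤ κ a b * Real.exp r)
    (u w : List L) :
    wnorm r (leibniz β u w) ≤ (w.map fun b => (u.map (κ · b)).sum).sum *
      Real.exp (r * u.length) * Real.exp (r * w.length) := by
  induction w with
  | nil => simp [leibniz]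
  | cons b w ih =>
    have hexp : Real.exp (r * (b :: w).length) = Real.exp r * Real.exp (r * w.length) := by
      rw [← Real.exp_add]; push_cast [List.length_cons]; ring_nf
    calc wnorm r (leibniz β u (b :: w))
        ≤ wnorm r (leibnizLeft β u b) * wnorm r (word w) +
          wnorm r (FreeAlgebra.ι ℂ b) * wnorm r (leibniz β u w) :=
          (map_add_le_add _ _ _).trans (add_le_add (wnorm_mul_le _ _ _) (wnorm_mul_le _ _ _))
      _ ≤ Real.exp r * (wnorm r (leibnizLeft β u b) * Real.exp (r * w.length)) +
          Real.exp r * wnorm r (leibniz β u w) := by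
          rw [← word_singleton, wnorm_word, wnorm_word, List.length_singleton, Nat.cast_one,
            mul_one]
          exact add_le_add_left (le_mul_of_one_le_left (by positivity) (Real.one_le_exp hr)) _
      _ ≤ Real.exp r * ((u.map (κ · b)).sum * Real.exp (r * u.length) *
            Real.exp (r * w.length)) +
          Real.exp r * ((w.map fun b => (u.map (κ · b)).sum).sum *
            Real.exp (r * u.length) * Real.exp (r * w.length)) := by
          gcongr
          exact wnorm_leibnizLeft_le hβ u b
      _ = ((b :: w).map fun b => (u.map (κ · b)).sum).sum * Real.exp (r * u.length) *
            Real.exp (r * (b :: w).length) := by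
          rw [hexp, List.map_cons, List.sum_cons]; ring

end BracketNorm

end Words

/-! ### The bracket of spins -/

section SpinBracket

variable {d : ℕ}

/-- The letters `M_i(x)` of the noncommutative polynomials in the spins. -/
abbrev Letter (d : ℕ) : Type := Site d × Idx

/-- The bracket `{M_i(x), M_j(y)} = δ_{xy} ∑_k i ε̃_{ijk} M_k(y)` of two spins. -/
noncomputable def spinBracket (a b : Letter d) : FreeAlgebra ℂ (Letter d) :=
  if a.1 = b.1 then
    ∑ k : Idx, (Complex.I * (eps a.2 b.2 k : ℂ)) • FreeAlgebra.ι ℂ (b.1, k)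
  else 0

theorem sum_abs_eps_le_one (i j : Idx) : ∑ k : Idx, |eps i j k| ≤ 1 := by
  cases i <;> cases j <;> decide

theorem wnorm_spinBracket_le (r : ℝ) (a b : Letter d) :
    wnorm r (spinBracket a b) ≤ (if a.1 = b.1 then 1 else 0) * Real.exp r := by
  unfold spinBracket
  split_ifs with h
  · have hsum : ∑ k : Idx, |(eps a.2 b.2 k : ℝ)| ≤ 1 := by
      exact_mod_cast sum_abs_eps_le_one a.2 b.2
    refine (Finset.le_sum_of_subadditive (wnorm r) (map_zero _).le (map_add_le_add _) _ _).trans ?_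
    simp only [map_smul_eq_mul, ← word_singleton, wnorm_word, List.length_singleton, Nat.cast_one,
      mul_one, ← Finset.sum_mul]
    gcongr
    simpa using hsum
  · simp

/-- The part of `normalWord α` that consists of the letters `M_i(x)` with fixed `i`. -/
noncomputable def wordPart (i : Idx) (α : MultiIndex d) : List (Letter d) :=
  (α.support.image Prod.fst).toList.flatMap fun x => List.replicate (α (x, i)) (x, i)

/-- The normally ordered word of the monomial `M^α`. -/
noncomputable def normalWord (α : MultiIndex d) : List (Letter d) :=
  wordPart .plus α ++ wordPart .z α ++ wordPart .minus α

theorem count_wordPart (i : Idx) (α : MultiIndex d) (p : Letter d) :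
    (wordPart i α).count p = if p.2 = i then α p else 0 := by
  rw [wordPart, List.count_flatMap]
  change ((α.support.image Prod.fst).toList.map
    fun x => (List.replicate (α (x, i)) (x, i)).count p).sum = _
  rw [Finset.sum_map_toList]
  obtain ⟨x, j⟩ := p
  simp only [List.count_replicate, beq_iff_eq, Prod.mk.injEq]
  by_cases hj : j = i
  · subst hj
    simp +contextual
  · simp [hj, Ne.symm hj]

theorem count_normalWord (α : MultiIndex d) (p : Letter d) : (normalWord α).count p = α p := by
  simp only [normalWord, List.count_append, count_wordPart]
  obtain ⟨x, i⟩ := p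
  cases i <;> simp

theorem coe_normalWord (α : MultiIndex d) :
    (normalWord α : Multiset (Letter d)) = Finsupp.toMultiset α := by
  classical
  ext p
  rw [Finsupp.count_toMultiset, Multiset.coe_count, ← count_normalWord]
  congr!

theorem length_normalWord (α : MultiIndex d) : (normalWord α).length = α.degree := by
  rw [← Multiset.coe_card, coe_normalWord, Finsupp.card_toMultiset]
  rfl

@[to_additive]
theorem prod_map_normalWord {R : Type*} [CommMonoid R] (f : Letter d → R) (α : MultiIndex d) :
    ((normalWord α).map f).prod = α.prod fun p e => f p ^ e := by
  rw [← Multiset.prod_coe, ← Multiset.map_coe, coe_normalWord, Finsupp.toMultiset_map,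
    Finsupp.prod_toMultiset, Finsupp.prod_mapDomain_index pow_zero pow_add]

theorem sum_map_site_normalWord (x : Site d) (α : MultiIndex d) :
    ((normalWord α).map fun a => if a.1 = x then (1 : ℝ) else 0).sum = α.at x := by
  rw [sum_map_normalWord, MultiIndex.at]
  induction α using Finsupp.induction_linear with
  | zero => simp
  | add α β ihα ihβ =>
    rw [Finsupp.sum_add_index' (by simp) (fun _ _ _ => add_smul _ _ _), ihα, ihβ]
    simp [Finset.sum_add_distrib]
  | single p n =>
    obtain ⟨y, i⟩ := p
    by_cases h : y = x
    · subst h; simp [Finsupp.single_apply]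
    · simp [h]

/-- The bracket `{M^α, ·}` with the normally ordered monomial `M^α`. -/
noncomputable def monomialBracket (α : MultiIndex d) :
    FreeAlgebra ℂ (Letter d) →ₗ[ℂ] FreeAlgebra ℂ (Letter d) :=
  bracket spinBracket (normalWord α)

theorem wnorm_monomialBracket_word_le {r : ℝ} (hr : 0 ≤ r) (hr1 : r ≤ 1) (α : MultiIndex d)
    (w : List (Letter d)) :
    wnorm r (monomialBracket α (word w)) ≤
      (w.map fun b => (α.at b.1 : ℝ)).sum * Real.exp α.degree * Real.exp (r * w.length) := by
  have hle := wnorm_leibniz_le hr (wnorm_spinBracket_le r) (normalWord α) w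
  simp only [sum_map_site_normalWord, length_normalWord] at hle
  rw [monomialBracket, bracket_word]
  refine hle.trans ?_
  have hsum : 0 ≤ (w.map fun b => (α.at b.1 : ℝ)).sum :=
    List.sum_nonneg (List.forall_mem_map.2 fun _ _ => Nat.cast_nonneg _)
  gcongr
  exact mul_le_of_le_one_left (by positivity) hr1

end SpinBracket

/-! ### Potentials of finite norm -/

/-- `K` bounds all the sums `∑_α |α(x)| |V(α)| e^{|α|}`. -/
def Potential.BoundedBy {d : ℕ} (V : Potential d) (K : ℝ) : Prop :=
  ∀ (x : Site d) (F : Finset (MultiIndex d)),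
    ∑ α ∈ F, (α.at x : ℝ) * ‖V α‖ * Real.exp (α.degree : ℝ) ≤ K

section BoundedBy

variable {d : ℕ} {V V' : Potential d} {K : ℝ}

theorem Potential.boundedBy_of_norm_lt_top (h : V.norm < ⊤) : V.BoundedBy V.norm.toReal := by
  intro x F
  have hle : ∑ α ∈ F, (α.at x : ℝ≥0∞) * ‖V α‖ₑ * ENNReal.ofReal (Real.exp (α.degree : ℝ)) ≤
      V.norm := by
    refine (ENNReal.sum_le_tsum F).trans ?_
    rw [← (Equiv.sigmaFiberEquiv (fun α : MultiIndex d => α.degree)).tsum_eq, ENNReal.tsum_sigma']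
    refine ENNReal.tsum_le_tsum fun n => le_iSup_of_le x ?_
    refine ENNReal.tsum_le_tsum fun ⟨α, hα⟩ => ?_
    subst hα
    exact le_rfl
  have hreal := ENNReal.toReal_mono h.ne hle
  rw [ENNReal.toReal_sum (fun α _ => by finiteness)] at hreal
  simpa [ENNReal.toReal_mul, ENNReal.toReal_ofReal (Real.exp_pos _).le] using hreal

theorem Potential.BoundedBy.mono (h : V.BoundedBy K) (hV : ∀ α, ‖V' α‖ ≤ ‖V α‖) :
    V'.BoundedBy K := by
  refine fun x F => le_trans ?_ (h x F)
  gcongr with α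
  exact hV α

theorem Potential.BoundedBy.nonneg (h : V.BoundedBy K) : 0 ≤ K := by simpa using h 0 ∅

theorem sum_norm_mul_wnorm_monomialBracket_word_le (hV : V.BoundedBy K) {r : ℝ} (hr : 0 ≤ r)
    (hr1 : r ≤ 1) (w : List (Letter d)) (F : Finset (MultiIndex d)) :
    ∑ α ∈ F, ‖V α‖ * wnorm r (monomialBracket α (word w)) ≤
      w.length * K * Real.exp (r * w.length) := by
  have hsite : ∑ α ∈ F, ‖V α‖ * ((w.map fun b => (α.at b.1 : ℝ)).sum * Real.exp α.degree) ≤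
      w.length * K := by
    induction w with
    | nil => simp
    | cons b w ih =>
      calc _ = ∑ α ∈ F, (α.at b.1 : ℝ) * ‖V α‖ * Real.exp α.degree +
            ∑ α ∈ F, ‖V α‖ * ((w.map fun b => (α.at b.1 : ℝ)).sum * Real.exp α.degree) := by
            rw [← Finset.sum_add_distrib]
            refine Finset.sum_congr rfl fun α _ => ?_
            rw [List.map_cons, List.sum_cons]
            ring
        _ ≤ K + w.length * K := add_le_add (hV b.1 F) ih
        _ = (b :: w).length * K := by push_cast [List.length_cons]; ring
  calc _ ≤ ∑ α ∈ F, ‖V α‖ * ((w.map fun b => (α.at b.1 : ℝ)).sum * Real.exp α.degree *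
        Real.exp (r * w.length)) := by
        gcongr with α
        exact wnorm_monomialBracket_word_le hr hr1 α w
    _ = (∑ α ∈ F, ‖V α‖ * ((w.map fun b => (α.at b.1 : ℝ)).sum * Real.exp α.degree)) *
        Real.exp (r * w.length) := by
        simp only [Finset.sum_mul, mul_assoc]
    _ ≤ _ := by gcongr

/-- As in Cauchy's estimate, lowering the weight by `h` pays for the factor `|w|` of the Leibniz
rule, because `|w| ≤ e^{h |w|} / h`. -/
theorem sum_norm_mul_wnorm_monomialBracket_le (hV : V.BoundedBy K) {r h : ℝ} (hr : 0 ≤ r)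
    (hr1 : r ≤ 1) (hh : 0 < h) (B : FreeAlgebra ℂ (Letter d)) (F : Finset (MultiIndex d)) :
    ∑ α ∈ F, ‖V α‖ * wnorm r (monomialBracket α B) ≤ K / h * wnorm (r + h) B := by
  let p : Seminorm ℂ (FreeAlgebra ℂ (Letter d)) :=
    ∑ α ∈ F, ‖V α‖₊ • (wnorm r).comp (monomialBracket α)
  have hp (C : FreeAlgebra ℂ (Letter d)) :
      p C = ∑ α ∈ F, ‖V α‖ * wnorm r (monomialBracket α C) := by
    simp only [p, FunLike.coe_sum, Finset.sum_apply]
    rfl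
  rw [← hp]
  refine seminorm_le_mul_wnorm (fun w => ?_) B
  rw [hp]
  have hK := hV.nonneg
  have hlength : (w.length : ℝ) ≤ Real.exp (h * w.length) / h := by
    rw [le_div_iff₀' hh]
    linarith [Real.add_one_le_exp (h * w.length)]
  calc _ ≤ w.length * K * Real.exp (r * w.length) :=
        sum_norm_mul_wnorm_monomialBracket_word_le hV hr hr1 w F
    _ ≤ Real.exp (h * w.length) / h * K * Real.exp (r * w.length) := by gcongr
    _ = K / h * Real.exp ((r + h) * w.length) := by rw [add_mul, Real.exp_add]; ring

theorem summable_norm_mul_wnorm_monomialBracket (hV : V.BoundedBy K)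
    (B : FreeAlgebra ℂ (Letter d)) :
    Summable fun α => ‖V α‖ * wnorm (1 / 2) (monomialBracket α B) :=
  summable_of_sum_le (fun α => by positivity)
    (sum_norm_mul_wnorm_monomialBracket_le hV (by norm_num) (by norm_num) one_half_pos B)

end BoundedBy

/-! ### The equation of motion on the free algebra -/

section Velocity

variable {d : ℕ} {V V' : Potential d} {K : ℝ} {E : Type*} [NormedAddCommGroup E]
  [NormedSpace ℂ E] {ℓ : FreeAlgebra ℂ (Letter d) →ₗ[ℂ] E}

/-- The time derivative `∑_α V(α) ⟨{M^α, B}⟩` of the value of `B`, if `⟨C⟩ = ℓ C` is the present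
value of `C` for all noncommutative polynomials `C`. -/
noncomputable def velocity (V : Potential d) (ℓ : FreeAlgebra ℂ (Letter d) →ₗ[ℂ] E)
    (B : FreeAlgebra ℂ (Letter d)) : E :=
  ∑' α, V α • ℓ (monomialBracket α B)

theorem norm_smul_monomialBracket_le {C : ℝ}
    (hℓ : ∀ w, ‖ℓ (word w)‖ ≤ C * Real.exp (1 / 2 * w.length)) (B : FreeAlgebra ℂ (Letter d))
    (α : MultiIndex d) :
    ‖V α • ℓ (monomialBracket α B)‖ ≤ C * (‖V α‖ * wnorm (1 / 2) (monomialBracket α B)) := by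
  rw [norm_smul, mul_left_comm]
  gcongr
  exact norm_le_mul_wnorm hℓ (monomialBracket α B)

theorem norm_velocity_le (hV : V.BoundedBy K) {C : ℝ} (hC : 0 ≤ C)
    (hℓ : ∀ w, ‖ℓ (word w)‖ ≤ C * Real.exp (1 / 2 * w.length)) {h : ℝ} (hh : 0 < h)
    (B : FreeAlgebra ℂ (Letter d)) :
    ‖velocity V ℓ B‖ ≤ C * (K / h * wnorm (1 / 2 + h) B) := by
  have hs := summable_norm_mul_wnorm_monomialBracket hV B
  calc ‖velocity V ℓ B‖
      ≤ C * ∑' α, ‖V α‖ * wnorm (1 / 2) (monomialBracket α B) :=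
        tsum_of_norm_bounded (hs.hasSum.mul_left C) (norm_smul_monomialBracket_le hℓ B)
    _ ≤ C * (K / h * wnorm (1 / 2 + h) B) := by
        gcongr
        exact hs.tsum_le_of_sum_le
          (sum_norm_mul_wnorm_monomialBracket_le hV (by norm_num) (by norm_num) hh B)

variable [CompleteSpace E]

theorem hasSum_velocity (hV : V.BoundedBy K)
    (hℓ : ∀ w, ‖ℓ (word w)‖ ≤ Real.exp (1 / 2 * w.length)) (B : FreeAlgebra ℂ (Letter d)) :
    HasSum (fun α => V α • ℓ (monomialBracket α B)) (velocity V ℓ B) :=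
  (Summable.of_norm_bounded ((summable_norm_mul_wnorm_monomialBracket hV B).mul_left 1)
    (norm_smul_monomialBracket_le (by simpa using hℓ) B)).hasSum

theorem velocity_eq_sum_word (hV : V.BoundedBy K)
    (hℓ : ∀ w, ‖ℓ (word w)‖ ≤ Real.exp (1 / 2 * w.length)) (B : FreeAlgebra ℂ (Letter d)) :
    velocity V ℓ B = ∑ w ∈ ((wordBasis (Letter d)).repr B).support,
      (wordBasis (Letter d)).repr B w • velocity V ℓ (word w) := by
  have hsum := hasSum_sum (s := ((wordBasis (Letter d)).repr B).support) fun w _ =>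
    (hasSum_velocity hV hℓ (word w)).const_smul ((wordBasis (Letter d)).repr B w)
  refine (hasSum_velocity hV hℓ B).unique (hsum.congr_fun fun α => ?_)
  conv_lhs => rw [← sum_repr_smul_word B]
  simp only [map_sum, map_smul, Finset.smul_sum, smul_comm (V α)]

/-- The finite part of the derivation `∑_α V(α) {M^α, ·}` that belongs to `α ∈ F`. -/
noncomputable def finBracket (V : Potential d) (F : Finset (MultiIndex d))
    (B : FreeAlgebra ℂ (Letter d)) : FreeAlgebra ℂ (Letter d) :=
  ∑ α ∈ F, V α • monomialBracket α B

theorem wnorm_finBracket_le (hV : V.BoundedBy K) {r h : ℝ} (hr : 0 ≤ r) (hr1 : r ≤ 1)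
    (hh : 0 < h) (F : Finset (MultiIndex d)) (B : FreeAlgebra ℂ (Letter d)) :
    wnorm r (finBracket V F B) ≤ K / h * wnorm (r + h) B := by
  refine (Finset.le_sum_of_subadditive (wnorm r) (map_zero _).le (map_add_le_add _) _ _).trans ?_
  simp only [map_smul_eq_mul]
  exact sum_norm_mul_wnorm_monomialBracket_le hV hr hr1 hh B F

/-- `V'` is dominated by `V` and agrees with it on `F`. -/
structure Potential.Approximates (V' V : Potential d) (F : Finset (MultiIndex d)) : Prop where
  norm_le : ∀ α, ‖V' α‖ ≤ ‖V α‖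
  eq_of_mem : ∀ α ∈ F, V' α = V α

theorem Potential.Approximates.mono {F G : Finset (MultiIndex d)} (h : V'.Approximates V G)
    (hFG : F ⊆ G) : V'.Approximates V F :=
  ⟨h.norm_le, fun α hα => h.eq_of_mem α (hFG hα)⟩

theorem Potential.Approximates.refl (V : Potential d) (F : Finset (MultiIndex d)) :
    V.Approximates V F :=
  ⟨fun _ => le_rfl, fun _ _ => rfl⟩

theorem exists_norm_velocity_sub_finBracket_le (hV : V.BoundedBy K)
    (B : FreeAlgebra ℂ (Letter d)) {δ : ℝ} (hδ : 0 < δ) :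
    ∃ F : Finset (MultiIndex d), ∀ V' : Potential d, V'.Approximates V F →
      ∀ {E : Type} [NormedAddCommGroup E] [NormedSpace ℂ E] [CompleteSpace E]
        {ℓ : FreeAlgebra ℂ (Letter d) →ₗ[ℂ] E},
        (∀ w, ‖ℓ (word w)‖ ≤ Real.exp (1 / 2 * w.length)) →
          ‖velocity V' ℓ B - ℓ (finBracket V F B)‖ ≤ δ := by
  classical
  obtain ⟨F, hF⟩ :=
    summable_iff_vanishing_norm.1 (summable_norm_mul_wnorm_monomialBracket hV B) δ hδ
  refine ⟨F, fun V' hV' E _ _ _ ℓ hℓ => ?_⟩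
  have hfin : ℓ (finBracket V F B) = ∑ α ∈ F, V' α • ℓ (monomialBracket α B) := by
    rw [finBracket, map_sum]
    refine Finset.sum_congr rfl fun α hα => ?_
    rw [map_smul, hV'.eq_of_mem α hα]
  refine le_of_tendsto ((hasSum_velocity (hV.mono hV'.norm_le) hℓ B).sub_const _).norm ?_
  filter_upwards [eventually_ge_atTop F] with S hS
  rw [hfin, ← Finset.sum_sdiff_eq_sub hS]
  calc _ ≤ ∑ α ∈ S \ F, ‖V α‖ * wnorm (1 / 2) (monomialBracket α B) :=
        norm_sum_le_of_le _ fun α _ =>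
          (norm_smul_monomialBracket_le (C := 1) (by simpa using hℓ) B α).trans (by
            rw [one_mul]
            exact mul_le_mul_of_nonneg_right (hV'.norm_le α) (by positivity))
    _ ≤ δ := (le_abs_self _).trans (hF (S \ F) Finset.sdiff_disjoint).le

end Velocity

/-- `f` solves the equation of motion of the potential `V`: `f t B` is the value at time `t` of
the noncommutative polynomial `B` in the spins. The bound allows for values `≤ e^{1/2}` of the
single spins. -/
structure IsWordSolution {d : ℕ} (V : Potential d) {E : Type*} [NormedAddCommGroup E]
    [NormedSpace ℂ E] (f : ℝ → FreeAlgebra ℂ (Letter d) →ₗ[ℂ] E) : Prop where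
  norm_word_le : ∀ t w, ‖f t (word w)‖ ≤ Real.exp (1 / 2 * w.length)
  hasDerivAt_word : ∀ t w, HasDerivAt (fun τ => f τ (word w)) (velocity V (f t) (word w)) t

namespace IsWordSolution

variable {d : ℕ} {V : Potential d} {K : ℝ} {E : Type*} [NormedAddCommGroup E] [NormedSpace ℂ E]
  {f : ℝ → FreeAlgebra ℂ (Letter d) →ₗ[ℂ] E}

theorem shift (hf : IsWordSolution V f) (u : ℝ) : IsWordSolution V fun t => f (t + u) where
  norm_word_le _ w := hf.norm_word_le _ w
  hasDerivAt_word t w := (hf.hasDerivAt_word (t + u) w).comp_add_const t u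

variable [CompleteSpace E]

theorem hasDerivAt (hf : IsWordSolution V f) (hV : V.BoundedBy K) (t : ℝ)
    (B : FreeAlgebra ℂ (Letter d)) :
    HasDerivAt (fun τ => f τ B) (velocity V (f t) B) t := by
  rw [velocity_eq_sum_word hV (hf.norm_word_le t)]
  have hsum : (fun τ => f τ B) = fun τ => ∑ w ∈ ((wordBasis (Letter d)).repr B).support,
      (wordBasis (Letter d)).repr B w • f τ (word w) := by
    funext τ
    simp only [← map_smul, ← map_sum, sum_repr_smul_word]
  rw [hsum]
  exact HasDerivAt.fun_sum fun w _ => (hf.hasDerivAt_word t w).const_smul _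

theorem norm_sub_le (hf : IsWordSolution V f) (hV : V.BoundedBy K) (t u : ℝ)
    (B : FreeAlgebra ℂ (Letter d)) :
    ‖f t B - f u B‖ ≤ 2 * K * wnorm 1 B * |t - u| := by
  have hbound (τ : ℝ) : ‖velocity V (f τ) B‖ ≤ 2 * K * wnorm 1 B := by
    refine (norm_velocity_le hV zero_le_one (by simpa using hf.norm_word_le τ) one_half_pos
      B).trans (le_of_eq ?_)
    rw [add_halves]
    ring
  exact Convex.norm_image_sub_le_of_norm_hasDerivWithin_le (s := Set.univ)
    (fun τ _ => (hf.hasDerivAt hV τ B).hasDerivWithinAt) (fun τ _ => hbound τ) convex_univ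
    (Set.mem_univ u) (Set.mem_univ t)

end IsWordSolution

/-! ### Approximate Taylor expansion -/

section Taylor

variable {E : Type*} [NormedAddCommGroup E] [NormedSpace ℝ E] {g g' : ℕ → ℝ → E}

theorem hasDerivAt_sum_taylor (hg : ∀ k τ, HasDerivAt (g k) (g' k τ) τ) (t : ℝ) (N : ℕ)
    (τ : ℝ) :
    HasDerivAt (fun τ => ∑ k ∈ Finset.range (N + 1), ((t - τ) ^ k / k.factorial) • g k τ)
      (∑ k ∈ Finset.range N, ((t - τ) ^ k / k.factorial) • (g' k τ - g (k + 1) τ) +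
        ((t - τ) ^ N / N.factorial) • g' N τ) τ := by
  induction N with
  | zero => simpa using hg 0 τ
  | succ N ih =>
    have hcoeff : HasDerivAt (fun τ : ℝ => (t - τ) ^ (N + 1) / (N + 1).factorial)
        (-((t - τ) ^ N / N.factorial)) τ := by
      refine ((((hasDerivAt_id τ).const_sub t).pow (N + 1)).div_const _).congr_deriv ?_
      rw [Nat.factorial_succ]
      push_cast
      field_simp
      simp
    simp only [Finset.sum_range_succ _ (N + 1)]
    refine (ih.add (hcoeff.smul (hg (N + 1) τ))).congr_deriv ?_
    rw [Finset.sum_range_succ, smul_sub, neg_smul]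
    abel

theorem norm_sub_sum_taylor_le (hg : ∀ k τ, HasDerivAt (g k) (g' k τ) τ) {N : ℕ} {δ R : ℝ}
    (hδ0 : 0 ≤ δ) (hδ : ∀ k < N, ∀ τ, ‖g' k τ - g (k + 1) τ‖ ≤ δ) (hR : ∀ τ, ‖g' N τ‖ ≤ R) (t : ℝ) :
    ‖g 0 t - ∑ k ∈ Finset.range (N + 1), (t ^ k / k.factorial) • g k 0‖ ≤
      (Real.exp |t| * δ + |t| ^ N / N.factorial * R) * |t| := by
  have hsmul {τ : ℝ} (hτ : τ ∈ Set.uIcc 0 t) (k : ℕ) {v : E} {b : ℝ} (hv : ‖v‖ ≤ b) :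
      ‖((t - τ) ^ k / k.factorial) • v‖ ≤ |t| ^ k / k.factorial * b := by
    have hτt : |t - τ| ≤ |t| := by simpa using Set.abs_sub_right_of_mem_uIcc hτ
    rw [norm_smul, norm_div, norm_pow, Real.norm_eq_abs, RCLike.norm_natCast]
    gcongr
  have hbound : ∀ τ ∈ Set.uIcc 0 t,
      ‖∑ k ∈ Finset.range N, ((t - τ) ^ k / k.factorial) • (g' k τ - g (k + 1) τ) +
        ((t - τ) ^ N / N.factorial) • g' N τ‖ ≤
      Real.exp |t| * δ + |t| ^ N / N.factorial * R := by
    intro τ hτ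
    refine norm_add_le_of_le ?_ ?_
    · calc _ ≤ ∑ k ∈ Finset.range N, |t| ^ k / k.factorial * δ :=
            norm_sum_le_of_le _ fun k hk => hsmul hτ k (hδ k (Finset.mem_range.1 hk) τ)
        _ ≤ Real.exp |t| * δ := by
            rw [← Finset.sum_mul]
            gcongr
            exact Real.sum_le_exp_of_nonneg (abs_nonneg t) N
    · exact hsmul hτ N (hR τ)
  have hmv := Convex.norm_image_sub_le_of_norm_hasDerivWithin_le
    (fun τ _ => (hasDerivAt_sum_taylor hg t N τ).hasDerivWithinAt) hbound (convex_uIcc 0 t)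
    Set.left_mem_uIcc Set.right_mem_uIcc
  have hend : ∑ k ∈ Finset.range (N + 1), ((t - t) ^ k / k.factorial) • g k t = g 0 t := by
    rw [Finset.sum_range_succ', Finset.sum_eq_zero fun k _ => by simp]
    simp
  simpa only [hend, sub_zero, Real.norm_eq_abs] using hmv

theorem tendsto_pow_div_factorial_mul_pow {a x : ℝ} (ha : 0 ≤ a) (hx : 0 ≤ x)
    (hax : a * x * Real.exp 1 < 1) :
    Tendsto (fun N : ℕ => x ^ N / N.factorial * (a * (N + 1)) ^ (N + 1)) atTop (𝓝 0) := by
  have hstirling (N : ℕ) :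
      ((N : ℝ) + 1) ^ (N + 1) / N.factorial ≤ (N + 1) * Real.exp 1 ^ (N + 1) := by
    have h := Real.pow_div_factorial_le_exp ((N : ℝ) + 1) (by positivity) (N + 1)
    rw [Nat.factorial_succ, Nat.cast_mul, Nat.cast_succ, div_le_iff₀ (by positivity)] at h
    rw [div_le_iff₀ (by positivity), ← Real.exp_nat_mul, mul_one, Nat.cast_succ]
    linarith
  have hq : 0 ≤ a * x * Real.exp 1 := by positivity
  have hlim : Tendsto (fun N : ℕ => a * Real.exp 1 *
      (N * (a * x * Real.exp 1) ^ N + (a * x * Real.exp 1) ^ N)) atTop (𝓝 0) := by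
    simpa using ((tendsto_self_mul_const_pow_of_lt_one hq hax).add
      (tendsto_pow_atTop_nhds_zero_of_lt_one hq hax)).const_mul (a * Real.exp 1)
  refine squeeze_zero (fun N => by positivity) (fun N => ?_) hlim
  calc x ^ N / N.factorial * (a * (N + 1)) ^ (N + 1)
      = x ^ N * a ^ (N + 1) * (((N : ℝ) + 1) ^ (N + 1) / N.factorial) := by
        rw [mul_pow]; ring
    _ ≤ x ^ N * a ^ (N + 1) * ((N + 1) * Real.exp 1 ^ (N + 1)) := by
        gcongr
        exact hstirling N
    _ = a * Real.exp 1 * (N * (a * x * Real.exp 1) ^ N + (a * x * Real.exp 1) ^ N) := by ring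

end Taylor

/-! ### Finite approximations of the evolution -/

section Approximation

variable {d : ℕ} {V : Potential d} {K : ℝ}

/-- The value of `A` at time `t` is within `ε` of the value of `B` at time `0`, uniformly over all
solutions of the equation of motion of all potentials that are dominated by `V` and agree with it
on the finite set `F`. -/
def IsApproxEvolution (V : Potential d) (F : Finset (MultiIndex d)) (ε t : ℝ)
    (A B : FreeAlgebra ℂ (Letter d)) : Prop :=
  ∀ V' : Potential d, V'.Approximates V F →
    ∀ {E : Type} [NormedAddCommGroup E] [NormedSpace ℂ E] [CompleteSpace E]
      {f : ℝ → FreeAlgebra ℂ (Letter d) →ₗ[ℂ] E}, IsWordSolution V' f → ‖f t A - f 0 B‖ ≤ ε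

theorem IsApproxEvolution.trans [DecidableEq (MultiIndex d)] {F₁ F₂ : Finset (MultiIndex d)}
    {ε₁ ε₂ t₁ t₂ : ℝ} {A B C : FreeAlgebra ℂ (Letter d)} (h₁ : IsApproxEvolution V F₁ ε₁ t₁ A B)
    (h₂ : IsApproxEvolution V F₂ ε₂ t₂ B C) :
    IsApproxEvolution V (F₁ ∪ F₂) (ε₁ + ε₂) (t₁ + t₂) A C := by
  intro V' hV' E _ _ _ f hf
  have hAB := h₁ V' (hV'.mono Finset.subset_union_left) (hf.shift t₂)
  have hBC := h₂ V' (hV'.mono Finset.subset_union_right) hf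
  rw [zero_add] at hAB
  rw [← sub_add_sub_cancel]
  exact norm_add_le_of_le hAB hBC

/-- The derivatives at time `0` of the value of `A`, with the derivation `∑_α V(α) {M^α, ·}`
truncated to finite sums, whose range `F B` may depend on the argument `B`. -/
noncomputable def iterBracket (V : Potential d)
    (F : FreeAlgebra ℂ (Letter d) → Finset (MultiIndex d)) (A : FreeAlgebra ℂ (Letter d)) :
    ℕ → FreeAlgebra ℂ (Letter d)
  | 0 => A
  | k + 1 => finBracket V (F (iterBracket V F A k)) (iterBracket V F A k)

theorem wnorm_iterBracket_le (hV : V.BoundedBy K)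
    (F : FreeAlgebra ℂ (Letter d) → Finset (MultiIndex d)) (A : FreeAlgebra ℂ (Letter d))
    {h : ℝ} (hh : 0 < h) (k : ℕ) (hk : k * h ≤ 1) :
    wnorm (1 - k * h) (iterBracket V F A k) ≤ (K / h) ^ k * wnorm 1 A := by
  induction k with
  | zero => simp [iterBracket]
  | succ k ih =>
    have hK := hV.nonneg
    have hkh : 0 ≤ k * h := by positivity
    push_cast at hk ⊢
    calc _ ≤ K / h * wnorm (1 - (k + 1) * h + h) (iterBracket V F A k) :=
          wnorm_finBracket_le hV (by linarith) (by linarith) hh _ _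
      _ = K / h * wnorm (1 - k * h) (iterBracket V F A k) := by ring_nf
      _ ≤ K / h * ((K / h) ^ k * wnorm 1 A) := by
          gcongr
          exact ih (by linarith)
      _ = (K / h) ^ (k + 1) * wnorm 1 A := by ring

theorem norm_velocity_iterBracket_le {V' : Potential d} (hV : V.BoundedBy K)
    (hV' : V'.BoundedBy K) {E : Type*} [NormedAddCommGroup E] [NormedSpace ℂ E]
    {ℓ : FreeAlgebra ℂ (Letter d) →ₗ[ℂ] E}
    (hℓ : ∀ w, ‖ℓ (word w)‖ ≤ Real.exp (1 / 2 * w.length))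
    (F : FreeAlgebra ℂ (Letter d) → Finset (MultiIndex d)) (A : FreeAlgebra ℂ (Letter d))
    (N : ℕ) :
    ‖velocity V' ℓ (iterBracket V F A N)‖ ≤ (2 * K * (N + 1)) ^ (N + 1) * wnorm 1 A := by
  have hK := hV.nonneg
  -- The weight decreases from `1` to `1/2` in `N + 1` equal steps `h`.
  obtain ⟨h, hh⟩ : ∃ h : ℝ, h = 1 / (2 * (N + 1)) := ⟨_, rfl⟩
  have hpos : 0 < h := by rw [hh]; positivity
  have hsteps : 1 / 2 + h = 1 - N * h := by rw [hh]; field_simp; ring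
  have hKh : K / h = 2 * K * (N + 1) := by rw [hh]; field_simp
  calc _ ≤ K / h * wnorm (1 - N * h) (iterBracket V F A N) := by
        simpa only [one_mul, hsteps] using
          norm_velocity_le hV' zero_le_one (by simpa using hℓ) hpos (iterBracket V F A N)
    _ ≤ K / h * ((K / h) ^ N * wnorm 1 A) := by
        gcongr
        exact wnorm_iterBracket_le hV F A hpos N (by linarith)
    _ = (2 * K * (N + 1)) ^ (N + 1) * wnorm 1 A := by rw [hKh]; ring

theorem exists_isApproxEvolution_of_small (hV : V.BoundedBy K) (A : FreeAlgebra ℂ (Letter d))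
    {t : ℝ} (ht : 2 * K * |t| * Real.exp 1 < 1) {ε : ℝ} (hε : 0 < ε) :
    ∃ F B, IsApproxEvolution V F ε t A B := by
  classical
  have hK := hV.nonneg
  obtain ⟨δ, hδ⟩ : ∃ δ : ℝ, δ = ε / (2 * (|t| + 1)) := ⟨_, rfl⟩
  have hδ0 : 0 < δ := by rw [hδ]; positivity
  choose F hF using fun B =>
    exists_norm_velocity_sub_finBracket_le hV B (div_pos hδ0 (Real.exp_pos |t|))
  have hlim := (tendsto_pow_div_factorial_mul_pow (by positivity) (abs_nonneg t) ht).mul_const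
    (wnorm 1 A)
  rw [zero_mul] at hlim
  obtain ⟨N, hN⟩ := (hlim.eventually (eventually_le_nhds hδ0)).exists
  let a := iterBracket V F A
  refine ⟨(Finset.range (N + 1)).biUnion fun k => F (a k),
    ∑ k ∈ Finset.range (N + 1), ((t ^ k / k.factorial : ℝ) : ℂ) • a k,
    fun V' hV' E _ _ _ f hf => ?_⟩
  have hV'K := hV.mono hV'.norm_le
  have htaylor := norm_sub_sum_taylor_le (fun k τ => hf.hasDerivAt hV'K τ (a k))
    (div_pos hδ0 (Real.exp_pos |t|)).le
    (fun k hk τ => hF (a k) V' (hV'.mono (Finset.subset_biUnion_of_mem (fun k => F (a k))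
      (Finset.mem_range.2 (Nat.lt_succ_of_lt hk)))) (hf.norm_word_le τ))
    (fun τ => norm_velocity_iterBracket_le hV hV'K (hf.norm_word_le τ) F A N) t
  have hB : f 0 (∑ k ∈ Finset.range (N + 1), ((t ^ k / k.factorial : ℝ) : ℂ) • a k) =
      ∑ k ∈ Finset.range (N + 1), (t ^ k / k.factorial) • f 0 (a k) := by
    simp only [map_sum, map_smul]
    rfl
  rw [hB]
  calc _ ≤ _ := htaylor
    _ ≤ (δ + δ) * |t| := by
        rw [mul_div_cancel₀ _ (Real.exp_pos _).ne', ← mul_assoc]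
        gcongr
    _ ≤ ε := by
        rw [hδ, ← two_mul, mul_comm (2 : ℝ), div_mul_eq_mul_div, div_mul_eq_mul_div,
          div_le_iff₀ (by positivity)]
        nlinarith [abs_nonneg t]

theorem exists_isApproxEvolution (hV : V.BoundedBy K) (A : FreeAlgebra ℂ (Letter d)) (t : ℝ)
    {ε : ℝ} (hε : 0 < ε) : ∃ F B, IsApproxEvolution V F ε t A B := by
  classical
  have hsteps (m : ℕ) {τ : ℝ} (hτ : 2 * K * |τ| * Real.exp 1 < 1) :
      ∀ (A : FreeAlgebra ℂ (Letter d)) {ε : ℝ}, 0 < ε →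
        ∃ F B, IsApproxEvolution V F ε (m * τ) A B := by
    induction m with
    | zero => exact fun A ε hε => ⟨∅, A, fun V' _ E _ _ _ f _ => by simpa using hε.le⟩
    | succ m ih =>
      intro A ε hε
      obtain ⟨F₁, B₁, h₁⟩ := exists_isApproxEvolution_of_small hV A hτ (half_pos hε)
      obtain ⟨F₂, B₂, h₂⟩ := ih B₁ (half_pos hε)
      refine ⟨F₁ ∪ F₂, B₂, ?_⟩
      have h := h₁.trans h₂
      rwa [add_halves, show τ + m * τ = (m + 1 : ℕ) * τ by push_cast; ring] at h
  obtain ⟨m, hm⟩ := exists_nat_gt (2 * K * |t| * Real.exp 1)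
  have hm0 : (0 : ℝ) < m := lt_of_le_of_lt (by have := hV.nonneg; positivity) hm
  have hsmall : 2 * K * |t / m| * Real.exp 1 < 1 := by
    rw [abs_div, Nat.abs_cast, ← mul_div_assoc, div_mul_eq_mul_div, div_lt_one hm0]
    exact hm
  have h := hsteps m hsmall A hε
  rwa [mul_div_cancel₀ _ hm0.ne'] at h

end Approximation

/-! ### Classical spins -/

theorem tendsto_of_dense {𝔅 𝔅' ι : Type*} [PseudoMetricSpace 𝔅] [PseudoMetricSpace 𝔅']
    {l : Filter ι} {T : ι → 𝔅 → 𝔅'} {T₀ : 𝔅 → 𝔅'} (hT : ∀ i, LipschitzWith 1 (T i))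
    (hT₀ : Continuous T₀) {S : Set 𝔅} (hS : Dense S)
    (h : ∀ a ∈ S, Tendsto (fun i => T i a) l (𝓝 (T₀ a))) (a : 𝔅) :
    Tendsto (fun i => T i a) l (𝓝 (T₀ a)) :=
  ((LipschitzWith.uniformEquicontinuous T 1 hT).equicontinuous.isClosed_setOfPred_tendsto
    hT₀).closure_subset_iff.2 h (hS a)

theorem continuous_of_dense {𝔅 𝔅' X : Type*} [PseudoMetricSpace 𝔅] [PseudoMetricSpace 𝔅']
    [TopologicalSpace X] {T : X → 𝔅 → 𝔅'} (hT : ∀ t, LipschitzWith 1 (T t)) {S : Set 𝔅}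
    (hS : Dense S) (h : ∀ a ∈ S, Continuous fun t => T t a) (a : 𝔅) :
    Continuous fun t => T t a :=
  continuous_iff_continuousAt.2 fun t =>
    tendsto_of_dense hT (hT t).continuous hS (fun a ha => (h a ha).tendsto t) a

theorem adjoin_range_le_range_lift {L 𝔅 : Type*} [Ring 𝔅] [StarRing 𝔅] [Algebra ℂ 𝔅]
    [StarModule ℂ 𝔅] {s : L → 𝔅} (hs : ∀ a, star (s a) ∈ Set.range s) :
    (StarAlgebra.adjoin ℂ (Set.range s)).toSubalgebra ≤ (FreeAlgebra.lift ℂ s).range := by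
  have hstar : star (Set.range s) ⊆ Set.range s := by
    rintro y ⟨a, ha⟩
    rw [← star_star y, ← ha]
    exact hs a
  rw [StarAlgebra.adjoin_toSubalgebra, Set.union_eq_self_of_subset_right hstar,
    Algebra.adjoin_range_eq_range_freeAlgebra_lift]

theorem bracket_one {L : Type*} (β : L → L → FreeAlgebra ℂ L) (u : List L) :
    bracket β u 1 = 0 := by
  rw [← word_nil, bracket_word, leibniz]

theorem bracket_ι {L : Type*} (β : L → L → FreeAlgebra ℂ L) (u : List L) (b : L) :
    bracket β u (FreeAlgebra.ι ℂ b) = leibnizLeft β u b := by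
  simp [← word_singleton, bracket_word, leibniz]

theorem bracket_ι_mul_word {L : Type*} (β : L → L → FreeAlgebra ℂ L) (u : List L) (b : L)
    (w : List L) :
    bracket β u (FreeAlgebra.ι ℂ b * word w) =
      bracket β u (FreeAlgebra.ι ℂ b) * word w + FreeAlgebra.ι ℂ b * bracket β u (word w) := by
  rw [← word_cons, bracket_word, bracket_word, bracket_ι, leibniz]

theorem lift_leibnizLeft {L : Type*} {χ : L → ℂ} {β : L → L → FreeAlgebra ℂ L} {b : L}
    {D : Derivation ℂ (MvPolynomial L ℂ) (MvPolynomial L ℂ)}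
    (hD : ∀ a, MvPolynomial.eval χ (D (MvPolynomial.X a)) = FreeAlgebra.lift ℂ χ (β a b))
    (u : List L) :
    FreeAlgebra.lift ℂ χ (leibnizLeft β u b) =
      MvPolynomial.eval χ (D (u.map MvPolynomial.X).prod) := by
  induction u with
  | nil => simp [leibnizLeft]
  | cons a u ih =>
    have hu : FreeAlgebra.lift ℂ χ (word u) = MvPolynomial.eval χ (u.map MvPolynomial.X).prod := by
      simp [lift_word, map_list_prod, Function.comp_def]
    rw [leibnizLeft, map_add, map_mul, map_mul, FreeAlgebra.lift_ι_apply, ih, ← hD, hu,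
      List.map_cons, List.prod_cons, Derivation.leibniz]
    simp only [smul_eq_mul, map_add, map_mul, MvPolynomial.eval_X]
    ring

section Classical

variable {d : ℕ} {V : Potential d} {K : ℝ}

/-- The complex coordinates `m_± = (m₁ ± i m₂)/√2` and `m_z = m₃` on `ℝ³`, as linear maps. -/
noncomputable def coordL (i : Idx) : EuclideanSpace ℝ (Fin 3) →L[ℝ] ℂ :=
  LinearMap.toContinuousLinearMap
    { toFun := fun m => match i with
        | .plus => ((m 0 : ℂ) + Complex.I * (m 1 : ℂ)) / (Real.sqrt 2 : ℂ)
        | .z => (m 2 : ℂ)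
        | .minus => ((m 0 : ℂ) - Complex.I * (m 1 : ℂ)) / (Real.sqrt 2 : ℂ)
      map_add' := fun m m' => by cases i <;> simp <;> ring
      map_smul' := fun c m => by cases i <;> simp <;> ring }

theorem coord_eq_coordL (i : Idx) (m : Ball3) : coord i m = coordL i m.1 := by
  cases i <;> rfl

theorem star_coordL (i : Idx) (m : EuclideanSpace ℝ (Fin 3)) :
    star (coordL i m) = coordL i.bar m := by
  cases i <;> simp [coordL, Idx.bar, sub_eq_add_neg]

theorem sum_Idx {𝔅 : Type*} [AddCommMonoid 𝔅] (g : Idx → 𝔅) :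
    ∑ i, g i = g .plus + g .z + g .minus := by
  change ∑ i ∈ {Idx.plus, Idx.z, Idx.minus}, g i = _
  simp [add_assoc]

theorem inner_eq_sum_coordL (v w : EuclideanSpace ℝ (Fin 3)) :
    ((inner ℝ v w : ℝ) : ℂ) = ∑ i : Idx, coordL i.bar v * coordL i w := by
  have h2 : (Real.sqrt 2 : ℂ) ^ 2 = 2 := by
    rw [← Complex.ofReal_pow, Real.sq_sqrt (by norm_num), Complex.ofReal_ofNat]
  rw [PiLp.inner_apply, Fin.sum_univ_three, sum_Idx]
  simp only [RCLike.inner_apply, Real.ringHom_apply, Complex.ofReal_add, Complex.ofReal_mul, coordL,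
    Idx.bar, LinearMap.coe_toContinuousLinearMap', LinearMap.coe_mk, AddHom.coe_mk]
  field_simp
  rw [h2]
  linear_combination 2 * (v 1 : ℂ) * w 1 * Complex.I_sq

theorem norm_sq_eq_sum_coordL (v : EuclideanSpace ℝ (Fin 3)) :
    ‖v‖ ^ 2 = ∑ i : Idx, ‖coordL i v‖ ^ 2 := by
  have h := inner_eq_sum_coordL v v
  simp only [real_inner_self_eq_norm_sq, ← star_coordL, RCLike.star_def, Complex.conj_mul'] at h
  exact_mod_cast h

theorem norm_coordL_le (i : Idx) (v : EuclideanSpace ℝ (Fin 3)) : ‖coordL i v‖ ≤ ‖v‖ := by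
  rw [← sq_le_sq₀ (norm_nonneg _) (norm_nonneg _), norm_sq_eq_sum_coordL v]
  exact Finset.single_le_sum (f := fun i => ‖coordL i v‖ ^ 2) (fun _ _ => by positivity)
    (Finset.mem_univ i)

theorem norm_coord_le (i : Idx) (m : Ball3) : ‖coord i m‖ ≤ 1 :=
  coord_eq_coordL i m ▸ (norm_coordL_le i m.1).trans (mem_closedBall_zero_iff.1 m.2)

/-- The values of the letters `M_i(x)` at the spin configuration `M`. -/
noncomputable def letterVal (M : Phase d) (p : Letter d) : ℂ := coord p.2 (M p.1)

/-- The value of a noncommutative polynomial at the spin configuration `M`. -/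
noncomputable def evalAt (M : Phase d) : FreeAlgebra ℂ (Letter d) →ₐ[ℂ] ℂ :=
  FreeAlgebra.lift ℂ (letterVal M)

@[simp] theorem evalAt_ι (M : Phase d) (p : Letter d) :
    evalAt M (FreeAlgebra.ι ℂ p) = letterVal M p :=
  FreeAlgebra.lift_ι_apply _ _

theorem lift_classicalSpin_apply (B : FreeAlgebra ℂ (Letter d)) (M : Phase d) :
    FreeAlgebra.lift ℂ classicalSpin B M = evalAt M B :=
  DFunLike.congr_fun (FreeAlgebra.hom_ext (by ext; simp; rfl) :
    (ContinuousMap.evalAlgHom ℂ ℂ M).comp (FreeAlgebra.lift ℂ classicalSpin) = evalAt M) B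

theorem norm_evalAt_word_le_one (M : Phase d) (w : List (Letter d)) : ‖evalAt M (word w)‖ ≤ 1 :=
  (norm_lift_word_le (s := letterVal M) (fun p => norm_coord_le p.2 (M p.1)) w).trans_eq
    (one_pow _)

theorem norm_evalAt_word_le (M : Phase d) (w : List (Letter d)) :
    ‖evalAt M (word w)‖ ≤ Real.exp (1 / 2 * w.length) :=
  (norm_evalAt_word_le_one M w).trans (Real.one_le_exp (by positivity))

theorem evalAt_leibnizLeft (M : Phase d) (u : List (Letter d)) (x : Site d) (i : Idx) :
    evalAt M (leibnizLeft spinBracket u (x, i)) = ∑ j : Idx, ∑ k : Idx,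
      Complex.I * (eps j i k : ℂ) * letterVal M (x, k) * MvPolynomial.eval (letterVal M)
        (MvPolynomial.pderiv (x, j) (u.map MvPolynomial.X).prod) := by
  let c (j : Idx) : ℂ := ∑ k : Idx, Complex.I * (eps j i k : ℂ) * letterVal M (x, k)
  let D : Derivation ℂ (Poly d) (Poly d) :=
    ∑ j : Idx, c j • MvPolynomial.pderiv (x, j)
  have hD (P : Poly d) : MvPolynomial.eval (letterVal M) (D P) =
      ∑ j : Idx, c j * MvPolynomial.eval (letterVal M) (MvPolynomial.pderiv (x, j) P) := by
    have hDP : D P = ∑ j : Idx, c j • MvPolynomial.pderiv (x, j) P := by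
      rw [← Derivation.coeFnAddMonoidHom_apply, map_sum, Finset.sum_apply]
      rfl
    simp [hDP, MvPolynomial.smul_eval]
  have hX (a : Letter d) : MvPolynomial.eval (letterVal M) (D (MvPolynomial.X a)) =
      FreeAlgebra.lift ℂ (letterVal M) (spinBracket a (x, i)) := by
    obtain ⟨y, l⟩ := a
    rw [hD, spinBracket]
    by_cases hy : y = x
    · subst hy
      simp [c, MvPolynomial.pderiv_X, Pi.single_apply]
    · simp [MvPolynomial.pderiv_X, hy]
  rw [evalAt, lift_leibnizLeft hX, hD]
  simp only [c, Finset.sum_mul]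

theorem vectorField_eq_velocity (V : Potential d) (M : Phase d) (x : Site d) (i : Idx) :
    vectorField V M x i = velocity V (evalAt M).toLinearMap (FreeAlgebra.ι ℂ (x, i)) := by
  refine tsum_congr fun α => ?_
  have hα : ((normalWord α).map (MvPolynomial.X (R := ℂ))).prod = MvPolynomial.monomial α 1 := by
    rw [prod_map_normalWord, MvPolynomial.monomial_eq, map_one, one_mul]
  have heval (β : MultiIndex d) (k : Idx) : monomialAt (β + Finsupp.single (x, k) 1) M =
      letterVal M (x, k) * β.prod fun p e => letterVal M p ^ e := by
    have hsingle := Finsupp.prod_single_index (a := (x, k)) (b := 1)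
      (h := fun p e => letterVal M p ^ e) (pow_zero _)
    rw [pow_one] at hsingle
    rw [← hsingle, mul_comm]
    exact Finsupp.prod_add_index' (fun _ => pow_zero _) fun _ _ _ => pow_add _ _ _
  rw [smul_eq_mul, AlgHom.toLinearMap_apply, monomialBracket, bracket_ι, evalAt_leibnizLeft, hα]
  congr! 3 with j _ k
  rw [MvPolynomial.pderiv_monomial, MvPolynomial.eval_monomial, heval, one_mul]
  ring

/-- A curve of spin configurations that solves the equation of motion. -/
def IsSolutionCurve (V : Potential d) (m : ℝ → Phase d) : Prop :=
  ∀ (t : ℝ) (x : Site d) (i : Idx),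
    HasDerivAt (fun τ : ℝ => coord i (m τ x)) (vectorField V (m t) x i) t

namespace IsSolutionCurve

variable {m m' : ℝ → Phase d}

theorem shift (hm : IsSolutionCurve V m) (u : ℝ) : IsSolutionCurve V fun t => m (t + u) :=
  fun t x i => (hm (t + u) x i).comp_add_const t u

theorem isWordSolution (hm : IsSolutionCurve V m) (hV : V.BoundedBy K) :
    IsWordSolution V fun t => (evalAt (m t)).toLinearMap where
  norm_word_le t w := norm_evalAt_word_le (m t) w
  hasDerivAt_word t w := by
    have hvel := hasSum_velocity hV (ℓ := (evalAt (m t)).toLinearMap) (norm_evalAt_word_le (m t))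
    simp only [AlgHom.toLinearMap_apply] at hvel ⊢
    induction w with
    | nil => simpa [velocity, monomialBracket, bracket_one] using
        hasDerivAt_const t (1 : ℂ)
    | cons b w ih =>
      have hb := hm t b.1 b.2
      rw [vectorField_eq_velocity] at hb
      simp only [word_cons, map_mul, evalAt_ι]
      refine (hb.mul ih).congr_deriv (HasSum.unique ?_ (hvel (FreeAlgebra.ι ℂ b * word w)))
      refine (((hvel (FreeAlgebra.ι ℂ b)).mul_right (evalAt (m t) (word w))).add
        ((hvel (word w)).mul_left (letterVal (m t) b))).congr_fun fun α => ?_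
      simp only [monomialBracket, bracket_ι_mul_word, map_add, map_mul, evalAt_ι, smul_eq_mul]
      ring

end IsSolutionCurve

theorem letterVal_injective : Function.Injective (letterVal : Phase d → Letter d → ℂ) := by
  intro M M' h
  funext x
  have hcoord (i : Idx) : coordL i ((M x).1 - (M' x).1) = 0 := by
    rw [map_sub, ← coord_eq_coordL, ← coord_eq_coordL]
    exact sub_eq_zero.2 (congr_fun h (x, i))
  have hnorm := norm_sq_eq_sum_coordL ((M x).1 - (M' x).1)
  simp only [hcoord, norm_zero] at hnorm
  exact Subtype.ext (sub_eq_zero.1 (norm_eq_zero.1 (by simpa using hnorm)))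

theorem isClosedEmbedding_letterVal :
    IsClosedEmbedding (letterVal : Phase d → Letter d → ℂ) :=
  (continuous_pi fun p : Letter d =>
    (continuous_coord p.2).comp (continuous_apply p.1)).isClosedEmbedding
    letterVal_injective

theorem IsFlow.isSolutionCurve {φ : ℝ → Phase d → Phase d} (hφ : IsFlow V φ) (M : Phase d) :
    IsSolutionCurve V fun t => φ t M := (hφ M).2

theorem IsSolutionCurve.ext (hV : V.BoundedBy K) {m m' : ℝ → Phase d} (hm : IsSolutionCurve V m)
    (hm' : IsSolutionCurve V m') (h0 : m 0 = m' 0) : m = m' := by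
  funext t
  refine letterVal_injective (funext fun p => eq_of_forall_dist_le fun ε hε => ?_)
  obtain ⟨F, B, h⟩ := exists_isApproxEvolution hV (FreeAlgebra.ι ℂ p) t (half_pos hε)
  have happrox {m : ℝ → Phase d} (hm : IsSolutionCurve V m) :
      dist (letterVal (m t) p) (evalAt (m 0) B) ≤ ε / 2 := by
    simpa [dist_eq_norm] using h V (.refl V F) (hm.isWordSolution hV)
  have hm0 := happrox hm
  rw [h0] at hm0
  linarith [dist_triangle_right (letterVal (m t) p) (letterVal (m' t) p) (evalAt (m' 0) B),
    happrox hm']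

namespace IsFlow

variable {φ ψ : ℝ → Phase d → Phase d}

theorem unique (hV : V.BoundedBy K) (hφ : IsFlow V φ) (hψ : IsFlow V ψ) : φ = ψ := by
  funext t M
  exact congr_fun ((hφ.isSolutionCurve M).ext hV (hψ.isSolutionCurve M)
    ((hφ M).1.trans (hψ M).1.symm)) t

theorem add (hV : V.BoundedBy K) (hφ : IsFlow V φ) (t u : ℝ) (M : Phase d) :
    φ (t + u) M = φ t (φ u M) :=
  congr_fun (((hφ.isSolutionCurve M).shift u).ext hV (hφ.isSolutionCurve (φ u M))
    (by simp [(hφ (φ u M)).1])) t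

theorem norm_evalAt_sub_le {V' : Potential d} {F : Finset (MultiIndex d)} {ε t : ℝ}
    {A B : FreeAlgebra ℂ (Letter d)} (hφ : IsFlow V' φ) (hV : V.BoundedBy K)
    (hV' : V'.Approximates V F) (h : IsApproxEvolution V F ε t A B) (M : Phase d) :
    ‖evalAt (φ t M) A - evalAt M B‖ ≤ ε := by
  simpa only [(hφ M).1, AlgHom.toLinearMap_apply] using
    h V' hV' ((hφ.isSolutionCurve M).isWordSolution (hV.mono hV'.norm_le))

theorem continuous (hV : V.BoundedBy K) (hφ : IsFlow V φ) (t : ℝ) : Continuous (φ t) := by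
  rw [isClosedEmbedding_letterVal.isInducing.continuous_iff]
  refine continuous_pi fun p => continuous_of_uniform_approx_of_continuous fun U hU => ?_
  obtain ⟨ε, hε, hεU⟩ := Metric.mem_uniformity_dist.1 hU
  obtain ⟨F, B, h⟩ := exists_isApproxEvolution hV (FreeAlgebra.ι ℂ p) t (half_pos hε)
  refine ⟨FreeAlgebra.lift ℂ classicalSpin B, ContinuousMap.continuous _, fun M => hεU ?_⟩
  have hM := hφ.norm_evalAt_sub_le hV (.refl V F) h M
  rw [evalAt_ι, ← dist_eq_norm] at hM
  rw [lift_classicalSpin_apply]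
  exact hM.trans_lt (half_lt_self hε)

/-- The homeomorphism of the phase space given by the flow at time `t`. -/
noncomputable def homeomorph (hV : V.BoundedBy K) (hφ : IsFlow V φ) (t : ℝ) :
    Phase d ≃ₜ Phase d where
  toFun := φ t
  invFun := φ (-t)
  left_inv M := by rw [← hφ.add hV, neg_add_cancel, (hφ M).1]
  right_inv M := by rw [← hφ.add hV, add_neg_cancel, (hφ M).1]
  continuous_toFun := hφ.continuous hV t
  continuous_invFun := hφ.continuous hV (-t)

/-- The automorphism `A ↦ A ∘ φ t` of the classical algebra. -/
noncomputable def automorphism (hV : V.BoundedBy K) (hφ : IsFlow V φ) (t : ℝ) :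
    ClassicalAlg d ≃⋆ₐ[ℂ] ClassicalAlg d :=
  (hφ.homeomorph hV t).compStarAlgEquiv' ℂ ℂ

@[simp] theorem automorphism_apply (hV : V.BoundedBy K) (hφ : IsFlow V φ) (t : ℝ)
    (A : ClassicalAlg d) (M : Phase d) : hφ.automorphism hV t A M = A (φ t M) := rfl

end IsFlow

theorem star_classicalSpin (p : Letter d) :
    star (classicalSpin p) = classicalSpin (p.1, p.2.bar) := by
  ext M
  simp [classicalSpin, coord_eq_coordL, ← star_coordL]

theorem dense_range_lift_classicalSpin :
    DenseRange (FreeAlgebra.lift ℂ (classicalSpin : Letter d → ClassicalAlg d)) := by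
  have hsep : (StarAlgebra.adjoin ℂ
      (Set.range (classicalSpin : Letter d → ClassicalAlg d))).SeparatesPoints := by
    intro M M' hne
    obtain ⟨p, hp⟩ := Function.ne_iff.1 (letterVal_injective.ne hne)
    exact ⟨_, ⟨classicalSpin p, StarAlgebra.subset_adjoin ℂ _ ⟨p, rfl⟩, rfl⟩, hp⟩
  have hdense : Dense (StarAlgebra.adjoin ℂ
      (Set.range (classicalSpin : Letter d → ClassicalAlg d)) : Set (ClassicalAlg d)) := by
    rw [dense_iff_closure_eq, ← StarSubalgebra.topologicalClosure_coe,
      ContinuousMap.starSubalgebra_topologicalClosure_eq_top_of_separatesPoints _ hsep,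
      StarSubalgebra.coe_top]
  exact hdense.mono (adjoin_range_le_range_lift fun p => ⟨_, (star_classicalSpin p).symm⟩)

theorem Potential.norm_restrict_le (V : Potential d) (Λ : Finset (Site d)) (α : MultiIndex d) :
    ‖V.restrict Λ α‖ ≤ ‖V α‖ := by
  unfold Potential.restrict
  split_ifs <;> simp

theorem eventually_restrict_approximates (V : Potential d) (F : Finset (MultiIndex d)) :
    ∀ᶠ Λ in atTop, (V.restrict Λ).Approximates V F := by
  classical
  filter_upwards [eventually_ge_atTop (F.biUnion fun α => α.support.image Prod.fst)] with Λ hΛ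
  refine ⟨V.norm_restrict_le Λ, fun α hα => if_pos fun p hp => ?_⟩
  exact hΛ (Finset.mem_biUnion.2 ⟨α, hα, Finset.mem_image_of_mem _ hp⟩)

namespace IsFlow

variable {φ : ℝ → Phase d → Phase d}

theorem continuous_automorphism (hV : V.BoundedBy K) (hφ : IsFlow V φ) (A : ClassicalAlg d) :
    Continuous fun t => hφ.automorphism hV t A := by
  refine continuous_of_dense (T := fun t A => hφ.automorphism hV t A)
    (fun t => (StarAlgEquiv.isometry (hφ.automorphism hV t)).lipschitz)
    dense_range_lift_classicalSpin ?_ A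
  rintro _ ⟨B, rfl⟩
  have hK : 0 ≤ 2 * K * wnorm 1 B := by have := hV.nonneg; positivity
  refine (LipschitzWith.of_dist_le_mul (K := ⟨_, hK⟩) fun t u => ?_).continuous
  rw [ContinuousMap.dist_le (by positivity)]
  intro M
  rw [automorphism_apply, automorphism_apply, lift_classicalSpin_apply, lift_classicalSpin_apply,
    dist_eq_norm]
  exact ((hφ.isSolutionCurve M).isWordSolution hV).norm_sub_le hV t u B

theorem tendsto_automorphism_restrict (hV : V.BoundedBy K) (hφ : IsFlow V φ)
    {ψ : Finset (Site d) → ℝ → Phase d → Phase d} (hψ : ∀ Λ, IsFlow (V.restrict Λ) (ψ Λ))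
    (t : ℝ) (A : ClassicalAlg d) :
    Tendsto (fun Λ => (hψ Λ).automorphism (hV.mono (V.norm_restrict_le Λ)) t A) atTop
      (𝓝 (hφ.automorphism hV t A)) := by
  have hVΛ (Λ : Finset (Site d)) := hV.mono (V.norm_restrict_le Λ)
  refine tendsto_of_dense (T := fun Λ A => (hψ Λ).automorphism (hVΛ Λ) t A)
    (T₀ := fun A => hφ.automorphism hV t A)
    (fun Λ => (StarAlgEquiv.isometry ((hψ Λ).automorphism (hVΛ Λ) t)).lipschitz)
    (StarAlgEquiv.isometry (hφ.automorphism hV t)).continuous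
    dense_range_lift_classicalSpin ?_ A
  rintro _ ⟨A, rfl⟩
  refine Metric.tendsto_nhds.2 fun ε hε => ?_
  obtain ⟨F, B, h⟩ := exists_isApproxEvolution hV A t (ε := ε / 3) (by positivity)
  filter_upwards [eventually_restrict_approximates V F] with Λ hΛ
  refine lt_of_le_of_lt (b := 2 * ε / 3) ?_ (by linarith)
  rw [ContinuousMap.dist_le (by positivity)]
  intro M
  have hψM := (hψ Λ).norm_evalAt_sub_le hV hΛ h M
  have hφM := hφ.norm_evalAt_sub_le hV (.refl V F) h M
  rw [← dist_eq_norm] at hψM hφM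
  simp only [automorphism_apply, lift_classicalSpin_apply]
  linarith [dist_triangle_right (evalAt (ψ Λ t M) A) (evalAt (φ t M) A) (evalAt M B)]

theorem isClassicalDynamics (hV : V.BoundedBy K) (hφ : IsFlow V φ)
    (hΛ : ∀ Λ, ∃ ψ, IsFlow (V.restrict Λ) ψ) :
    IsClassicalDynamics V (hφ.automorphism hV) where
  zero A := by ext M; simp [(hφ M).1]
  add t u A := by
    ext M
    simp only [automorphism_apply]
    rw [add_comm, hφ.add hV]
  continuous := hφ.continuous_automorphism hV
  limit := by
    choose ψ hψ using hΛ
    exact ⟨ψ, hψ, fun Λ₀ A _ t => ContinuousMap.tendsto_iff_tendstoUniformly.1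
      (hφ.tendsto_automorphism_restrict hV hψ t A)⟩
  flow := ⟨φ, hφ, fun t A M => rfl⟩

end IsFlow

theorem IsClassicalDynamics.unique (hV : V.BoundedBy K)
    {α β : ℝ → ClassicalAlg d ≃⋆ₐ[ℂ] ClassicalAlg d} (hα : IsClassicalDynamics V α)
    (hβ : IsClassicalDynamics V β) : α = β := by
  obtain ⟨φ, hφ, hαφ⟩ := hα.flow
  obtain ⟨ψ, hψ, hβψ⟩ := hβ.flow
  obtain rfl := hφ.unique hV hψ
  funext t
  ext A M
  rw [hαφ, hβψ]

end Classical

/-! ### Existence of the flow -/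

theorem exists_forall_hasDerivAt {E : Type*} [NormedAddCommGroup E] [NormedSpace ℝ E]
    [CompleteSpace E] {F : E → E} {k C : NNReal} (hF : LipschitzWith k F) (hC : ∀ x, ‖F x‖ ≤ C)
    (x₀ : E) : ∃ γ : ℝ → E, γ 0 = x₀ ∧ ∀ t, HasDerivAt γ (F (γ t)) t := by
  have hlocal (a : ℝ) : ∃ γ : ℝ → E, γ 0 = x₀ ∧
      ∀ t ∈ Set.Ioo (-a) a, HasDerivAt γ (F (γ t)) t := by
    have h0 : (0 : ℝ) ∈ Set.Icc (-|a|) |a| := by simp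
    have hPL : IsPicardLindelof (fun _ => F) (⟨0, h0⟩ : Set.Icc (-|a|) |a|) x₀
        (C * ‖a‖₊) 0 C k :=
      { lipschitzOnWith := fun _ _ => hF.lipschitzOnWith
        continuousOn := fun _ _ => continuousOn_const
        norm_le := fun _ _ x _ => hC x
        mul_max_le := by simp }
    obtain ⟨γ, hγ0, hγ⟩ := hPL.exists_eq_forall_mem_Icc_hasDerivWithinAt₀
    have hsub : Set.Ioo (-a) a ⊆ Set.Ioo (-|a|) |a| :=
      Set.Ioo_subset_Ioo (neg_le_neg (le_abs_self a)) (le_abs_self a)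
    exact ⟨γ, hγ0, fun t ht => (hγ t (Set.Ioo_subset_Icc_self (hsub ht))).hasDerivAt
      (Icc_mem_nhds (hsub ht).1 (hsub ht).2)⟩
  choose γ hγ0 hγ using hlocal
  have hagree {a b t : ℝ} (hab : a ≤ b) (ht : |t| < a) : γ a t = γ b t := by
    have ha : (0 : ℝ) < a := (abs_nonneg t).trans_lt ht
    have hsub : Set.Ioo (-a) a ⊆ Set.Ioo (-b) b := Set.Ioo_subset_Ioo (by linarith) hab
    exact ODE_solution_unique_of_mem_Ioo (v := fun _ => F) (s := fun _ => Set.univ) (K := k)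
      (fun _ _ => hF.lipschitzOnWith) ⟨neg_lt_zero.2 ha, ha⟩
      (fun u hu => ⟨hγ a u hu, Set.mem_univ _⟩) (fun u hu => ⟨hγ b u (hsub hu), Set.mem_univ _⟩)
      ((hγ0 a).trans (hγ0 b).symm) (abs_lt.1 ht)
  refine ⟨fun t => γ (|t| + 1) t, hγ0 _, fun t => ?_⟩
  have hnear : (fun u => γ (|u| + 1) u) =ᶠ[𝓝 t] γ (|t| + 2) := by
    filter_upwards [continuous_abs.continuousAt.eventually_lt_const (lt_add_one |t|)] with u hu
    exact hagree (by linarith) (lt_add_one _)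
  have ht := hγ (|t| + 2) t (abs_lt.1 (by linarith))
  rw [← hagree (by linarith) (lt_add_one |t|)] at ht
  exact ht.congr_of_eventuallyEq hnear

section Reality

variable {d : ℕ} {V : Potential d}

theorem Idx.bar_involutive : Function.Involutive Idx.bar := by
  rintro (_ | _ | _) <;> rfl

theorem eps_bar (i j k : Idx) : eps i.bar j.bar k.bar = -eps i j k := by
  cases i <;> cases j <;> cases k <;> rfl

/-- The involution `(x, i) ↦ (x, ī)` of the letters. -/
def letterBar : Letter d ≃ Letter d :=
  (Equiv.refl (Site d)).prodCongr Idx.bar_involutive.toPerm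

theorem MultiIndex.bar_eq_mapDomain (α : MultiIndex d) : α.bar = α.mapDomain letterBar := rfl

theorem MultiIndex.bar_apply (α : MultiIndex d) (x : Site d) (i : Idx) :
    α.bar (x, i) = α (x, i.bar) := by
  rw [bar_eq_mapDomain, Finsupp.mapDomain_equiv_apply]
  rfl

theorem MultiIndex.bar_involutive :
    Function.Involutive (MultiIndex.bar : MultiIndex d → MultiIndex d) := by
  intro α
  ext ⟨x, i⟩
  rw [bar_apply, bar_apply, Idx.bar_involutive]

theorem MultiIndex.bar_sub_add (α : MultiIndex d) (x : Site d) (j k : Idx) :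
    MultiIndex.bar (α - Finsupp.single (x, j) 1 + Finsupp.single (x, k) 1) =
      α.bar - Finsupp.single (x, j.bar) 1 + Finsupp.single (x, k.bar) 1 := by
  have hbar (j l : Idx) : j = l.bar ↔ j.bar = l :=
    (Idx.bar_involutive.eq_iff).symm
  ext ⟨y, l⟩
  simp [bar_apply, Finsupp.single_apply, hbar]

theorem star_monomialAt (β : MultiIndex d) (M : Phase d) :
    star (monomialAt β M) = monomialAt β.bar M := by
  rw [MultiIndex.bar_eq_mapDomain, monomialAt, monomialAt,
    Finsupp.prod_mapDomain_index_inj letterBar.injective, RCLike.star_def, map_finsuppProd]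
  simp [letterBar, coord_eq_coordL, ← star_coordL]

theorem Potential.IsReal.star_vectorField (hV : V.IsReal) (M : Phase d) (x : Site d) (i : Idx) :
    star (vectorField V M x i) = vectorField V M x i.bar := by
  have hsum (g : Idx → ℂ) : ∑ j, g j = ∑ j : Idx, g j.bar :=
    (Equiv.sum_comp Idx.bar_involutive.toPerm g).symm
  rw [vectorField, vectorField, tsum_star,
    ← Equiv.tsum_eq (MultiIndex.bar_involutive (d := d)).toPerm]
  refine tsum_congr fun α => ?_
  have hα : star (V α.bar) = V α :=
    (hV α.bar).trans (by rw [MultiIndex.bar_involutive])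
  have heps (j k : Idx) : eps j.bar i k.bar = -eps j i.bar k := by
    rw [← eps_bar, Idx.bar_involutive]
  rw [Function.Involutive.coe_toPerm, star_mul', hα, star_sum, hsum]
  congr! 2 with j
  rw [star_sum, hsum]
  congr! 1 with k
  simp [star_monomialAt, MultiIndex.bar_sub_add, MultiIndex.bar_apply, heps,
    MultiIndex.bar_involutive α, Idx.bar_involutive j, Idx.bar_involutive k]

theorem Potential.IsReal.restrict (hV : V.IsReal) (Λ : Finset (Site d)) :
    (V.restrict Λ).IsReal := by
  intro α
  have hsupport : (∀ p ∈ α.bar.support, p.1 ∈ Λ) ↔ ∀ p ∈ α.support, p.1 ∈ Λ := by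
    simp only [Prod.forall, Finsupp.mem_support_iff, MultiIndex.bar_apply]
    exact forall_congr' fun x =>
      (Idx.bar_involutive.surjective.forall (p := fun i => α (x, i) ≠ 0 → x ∈ Λ)).symm
  simp only [Potential.restrict, hsupport]
  split_ifs
  · exact hV α
  · exact map_zero _

end Reality

/-- The radial retraction of `ℝ³` onto the closed unit ball. -/
noncomputable def clip (m : EuclideanSpace ℝ (Fin 3)) : Ball3 :=
  ⟨(max 1 ‖m‖)⁻¹ • m, by
    have hpos : 0 < max 1 ‖m‖ := lt_max_of_lt_left one_pos
    rw [mem_closedBall_zero_iff, norm_smul, norm_inv, Real.norm_of_nonneg hpos.le,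
      inv_mul_le_iff₀ hpos, mul_one]
    exact le_max_right _ _⟩

theorem coe_clip (m : EuclideanSpace ℝ (Fin 3)) : (clip m).1 = (max 1 ‖m‖)⁻¹ • m := rfl

theorem clip_of_norm_le {m : EuclideanSpace ℝ (Fin 3)} (h : ‖m‖ ≤ 1) : (clip m).1 = m := by
  rw [coe_clip, max_eq_left h, inv_one, one_smul]

theorem norm_clip_sub_le (m m' : EuclideanSpace ℝ (Fin 3)) :
    ‖(clip m).1 - (clip m').1‖ ≤ 2 * ‖m - m'‖ := by
  set a := max 1 ‖m‖ with ha
  set b := max 1 ‖m'‖ with hb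
  have ha1 : 1 ≤ a := le_max_left _ _
  have hb1 : 1 ≤ b := le_max_left _ _
  have hab : |b - a| ≤ ‖m - m'‖ := by
    rw [abs_sub_comm]
    refine (abs_max_sub_max_le_max _ _ _ _).trans ?_
    simpa using abs_norm_sub_norm_le m m'
  have hsplit : (clip m).1 - (clip m').1 = a⁻¹ • (m - m') + ((b - a) / a) • (clip m').1 := by
    rw [coe_clip, coe_clip, ← ha, ← hb]
    match_scalars <;> field_simp
    ring
  have hfirst : ‖a⁻¹ • (m - m')‖ ≤ ‖m - m'‖ := by
    rw [norm_smul, norm_inv, Real.norm_of_nonneg (by positivity)]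
    exact mul_le_of_le_one_left (norm_nonneg _) (inv_le_one_of_one_le₀ ha1)
  have hsecond : ‖((b - a) / a) • (clip m').1‖ ≤ ‖m - m'‖ := by
    rw [norm_smul, norm_div, Real.norm_eq_abs, Real.norm_of_nonneg (zero_le_one.trans ha1)]
    exact (mul_le_of_le_one_right (by positivity) (mem_closedBall_zero_iff.1 (clip m').2)).trans
      ((div_le_self (abs_nonneg _) ha1).trans hab)
  rw [hsplit]
  linarith [norm_add_le (a⁻¹ • (m - m')) (((b - a) / a) • (clip m').1)]

/-- The real vector with complex coordinates `M_+ = a`, `M_z = Re b` and `M_- = conj a`. -/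
noncomputable def realVec (a b : ℂ) : EuclideanSpace ℝ (Fin 3) :=
  !₂[Real.sqrt 2 * a.re, Real.sqrt 2 * a.im, b.re]

theorem realVec_sub (a b a' b' : ℂ) :
    realVec a b - realVec a' b' = realVec (a - a') (b - b') := by
  ext k
  fin_cases k <;> simp [realVec, mul_sub]

theorem coordL_plus_realVec (a b : ℂ) : coordL .plus (realVec a b) = a := by
  have h2 : (Real.sqrt 2 : ℂ) ≠ 0 := by simp
  change (((Real.sqrt 2 * a.re : ℝ) : ℂ) + Complex.I * ((Real.sqrt 2 * a.im : ℝ) : ℂ)) /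
    (Real.sqrt 2 : ℂ) = a
  conv_rhs => rw [← Complex.re_add_im a]
  push_cast
  field_simp

theorem coordL_minus_realVec (a b : ℂ) : coordL .minus (realVec a b) = star a := by
  rw [← coordL_plus_realVec a b, star_coordL, Idx.bar, coordL_plus_realVec]

theorem coordL_z_realVec (a b : ℂ) : coordL .z (realVec a b) = b.re := rfl

theorem norm_realVec_le {a b : ℂ} {r : ℝ} (ha : ‖a‖ ≤ r) (hb : ‖b‖ ≤ r) :
    ‖realVec a b‖ ≤ 2 * r := by
  have hr : 0 ≤ r := (norm_nonneg a).trans ha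
  have hb' : ‖(b.re : ℂ)‖ ≤ r := by
    rw [Complex.norm_real]
    exact (Complex.abs_re_le_norm b).trans hb
  rw [← sq_le_sq₀ (norm_nonneg _) (by positivity), norm_sq_eq_sum_coordL, sum_Idx,
    coordL_plus_realVec, coordL_minus_realVec, coordL_z_realVec, norm_star]
  nlinarith [pow_le_pow_left₀ (norm_nonneg _) ha 2, pow_le_pow_left₀ (norm_nonneg _) hb' 2]

section Flow

variable {d : ℕ} {V : Potential d} {K : ℝ}

theorem norm_evalAt_word_sub_le {M M' : Phase d} {D : ℝ}
    (hD : ∀ p, ‖letterVal M p - letterVal M' p‖ ≤ D) (w : List (Letter d)) :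
    ‖evalAt M (word w) - evalAt M' (word w)‖ ≤ w.length * D := by
  induction w with
  | nil => simp
  | cons a w ih =>
    have hsplit : evalAt M (word (a :: w)) - evalAt M' (word (a :: w)) =
        letterVal M a * (evalAt M (word w) - evalAt M' (word w)) +
          (letterVal M a - letterVal M' a) * evalAt M' (word w) := by
      simp only [word_cons, map_mul, evalAt_ι]
      ring
    have hhead := mul_le_of_le_one_left (norm_nonneg (evalAt M (word w) - evalAt M' (word w)))
      (norm_coord_le a.2 (M a.1))
    have htail := mul_le_of_le_one_right (norm_nonneg (letterVal M a - letterVal M' a))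
      (norm_evalAt_word_le_one M' w)
    rw [hsplit, List.length_cons, Nat.cast_succ, add_one_mul]
    refine (norm_add_le _ _).trans ?_
    rw [norm_mul, norm_mul]
    exact add_le_add (hhead.trans ih) (htail.trans (hD a))

theorem norm_velocity_ι_le (hV : V.BoundedBy K) {ℓ : FreeAlgebra ℂ (Letter d) →ₗ[ℂ] ℂ} {C : ℝ}
    (hC : 0 ≤ C) (hℓ : ∀ w, ‖ℓ (word w)‖ ≤ C * Real.exp (1 / 2 * w.length)) (p : Letter d) :
    ‖velocity V ℓ (FreeAlgebra.ι ℂ p)‖ ≤ C * (2 * K * Real.exp 1) := by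
  have hwnorm : wnorm (1 / 2 + 1 / 2) (FreeAlgebra.ι ℂ p) = Real.exp 1 := by
    rw [← word_singleton, wnorm_word]
    norm_num
  refine (norm_velocity_le hV hC hℓ (h := 1 / 2) (by norm_num) (FreeAlgebra.ι ℂ p)).trans_eq ?_
  rw [hwnorm]
  ring

theorem norm_vectorField_le (hV : V.BoundedBy K) (M : Phase d) (x : Site d) (i : Idx) :
    ‖vectorField V M x i‖ ≤ 2 * K * Real.exp 1 := by
  rw [vectorField_eq_velocity]
  simpa using norm_velocity_ι_le hV zero_le_one (by simpa using norm_evalAt_word_le M) (x, i)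

theorem norm_vectorField_sub_le (hV : V.BoundedBy K) {M M' : Phase d} {D : ℝ}
    (hD : ∀ p, ‖letterVal M p - letterVal M' p‖ ≤ D) (x : Site d) (i : Idx) :
    ‖vectorField V M x i - vectorField V M' x i‖ ≤ 2 * D * (2 * K * Real.exp 1) := by
  have hD0 : 0 ≤ D := (norm_nonneg _).trans (hD (x, i))
  have hsub : velocity V ((evalAt M).toLinearMap - (evalAt M').toLinearMap)
      (FreeAlgebra.ι ℂ (x, i)) = vectorField V M x i - vectorField V M' x i := by
    rw [vectorField_eq_velocity, vectorField_eq_velocity]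
    refine HasSum.tsum_eq (((hasSum_velocity hV (norm_evalAt_word_le M) _).sub
      (hasSum_velocity hV (norm_evalAt_word_le M') _)).congr_fun fun α => ?_)
    rw [LinearMap.sub_apply, smul_sub]
  rw [← hsub]
  refine norm_velocity_ι_le hV (by positivity) (fun w => ?_) _
  refine (norm_evalAt_word_sub_le hD w).trans ?_
  nlinarith [Real.add_one_le_exp (1 / 2 * (w.length : ℝ))]

/-- The vector field in real coordinates. -/
noncomputable def realField (V : Potential d) (M : Phase d) (x : Site d) :
    EuclideanSpace ℝ (Fin 3) :=
  realVec (vectorField V M x .plus) (vectorField V M x .z)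

theorem coordL_realField (hreal : V.IsReal) (M : Phase d) (x : Site d) (i : Idx) :
    coordL i (realField V M x) = vectorField V M x i := by
  rw [realField]
  cases i
  · exact coordL_plus_realVec _ _
  · exact Complex.conj_eq_iff_re.1 (hreal.star_vectorField M x .z)
  · exact (coordL_minus_realVec _ _).trans (hreal.star_vectorField M x .plus)

theorem norm_realField_le (hV : V.BoundedBy K) (M : Phase d) (x : Site d) :
    ‖realField V M x‖ ≤ 2 * (2 * K * Real.exp 1) :=
  norm_realVec_le (norm_vectorField_le hV M x _) (norm_vectorField_le hV M x _)

theorem norm_realField_sub_le (hV : V.BoundedBy K) {M M' : Phase d} {D : ℝ}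
    (hD : ∀ x, ‖(M x).1 - (M' x).1‖ ≤ D) (x : Site d) :
    ‖realField V M x - realField V M' x‖ ≤ 2 * (2 * D * (2 * K * Real.exp 1)) := by
  have hletter (p : Letter d) : ‖letterVal M p - letterVal M' p‖ ≤ D := by
    rw [letterVal, letterVal, coord_eq_coordL, coord_eq_coordL, ← map_sub]
    exact (norm_coordL_le _ _).trans (hD p.1)
  rw [realField, realField, realVec_sub]
  exact norm_realVec_le (norm_vectorField_sub_le hV hletter x _)
    (norm_vectorField_sub_le hV hletter x _)

theorem sum_letterVal_mul_vectorField (hV : V.BoundedBy K) (M : Phase d) (x : Site d) :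
    ∑ i : Idx, letterVal M (x, i.bar) * vectorField V M x i = 0 := by
  simp only [vectorField_eq_velocity]
  refine HasSum.unique (hasSum_sum fun i _ => (hasSum_velocity hV (norm_evalAt_word_le M)
    (FreeAlgebra.ι ℂ (x, i))).mul_left (letterVal M (x, i.bar))) (hasSum_zero.congr_fun fun α => ?_)
  simp only [AlgHom.toLinearMap_apply, monomialBracket, bracket_ι, evalAt_leibnizLeft, sum_Idx,
    Idx.bar, eps, smul_eq_mul]
  push_cast
  ring

theorem inner_realField (hV : V.BoundedBy K) (hreal : V.IsReal) (M : Phase d) (x : Site d) :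
    inner ℝ (M x).1 (realField V M x) = 0 := by
  have h := sum_letterVal_mul_vectorField hV M x
  simp only [letterVal, coord_eq_coordL, ← coordL_realField hreal, ← inner_eq_sum_coordL] at h
  exact_mod_cast h

/-- The vector field on bounded families of vectors in `ℝ³`, extended from the phase space by the
radial retraction. The supremum norm makes it globally Lipschitz. -/
noncomputable def clippedField (hV : V.BoundedBy K)
    (m : BoundedContinuousFunction (Site d) (EuclideanSpace ℝ (Fin 3))) :
    BoundedContinuousFunction (Site d) (EuclideanSpace ℝ (Fin 3)) :=
  BoundedContinuousFunction.ofNormedAddCommGroupDiscrete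
    (fun x => realField V (fun y => clip (m y)) x) (2 * (2 * K * Real.exp 1))
    (norm_realField_le hV _)

theorem lipschitzWith_clippedField (hV : V.BoundedBy K) :
    LipschitzWith (16 * K * Real.exp 1).toNNReal (clippedField hV) := by
  have hK := hV.nonneg
  refine LipschitzWith.of_dist_le_mul fun m m' => ?_
  refine (BoundedContinuousFunction.dist_le (by positivity)).2 fun x => ?_
  have hclip (y : Site d) : ‖(clip (m y)).1 - (clip (m' y)).1‖ ≤ 2 * dist m m' := by
    refine (norm_clip_sub_le _ _).trans ?_
    rw [← dist_eq_norm]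
    gcongr
    exact BoundedContinuousFunction.dist_coe_le_dist _
  rw [dist_eq_norm, Real.coe_toNNReal _ (by positivity)]
  exact (norm_realField_sub_le hV hclip x).trans_eq (by ring)

theorem exists_clipped_solution (hV : V.BoundedBy K) (M₀ : Phase d) :
    ∃ v : ℝ → Site d → EuclideanSpace ℝ (Fin 3), (∀ x, v 0 x = (M₀ x).1) ∧
      ∀ t x, HasDerivAt (fun τ => v τ x) (realField V (fun y => clip (v t y)) x) t := by
  have hK := hV.nonneg
  have hbound (m) : ‖clippedField hV m‖ ≤ (2 * (2 * K * Real.exp 1)).toNNReal := by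
    rw [Real.coe_toNNReal _ (by positivity)]
    exact BoundedContinuousFunction.norm_ofNormedAddCommGroup_le _ (by positivity)
      (norm_realField_le hV _)
  obtain ⟨γ, hγ0, hγ⟩ := exists_forall_hasDerivAt (lipschitzWith_clippedField hV) hbound
    (BoundedContinuousFunction.ofNormedAddCommGroupDiscrete (fun x => (M₀ x).1) 1
      fun x => mem_closedBall_zero_iff.1 (M₀ x).2)
  refine ⟨fun t x => γ t x, fun x => by simp only [hγ0]; rfl, fun t x => ?_⟩
  exact (BoundedContinuousFunction.evalCLM ℝ x).hasFDerivAt.comp_hasDerivAt t (hγ t)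

theorem norm_eq_of_clipped_solution (hV : V.BoundedBy K) (hreal : V.IsReal)
    {v : ℝ → Site d → EuclideanSpace ℝ (Fin 3)} {x : Site d}
    (hv : ∀ t, HasDerivAt (fun τ => v τ x) (realField V (fun y => clip (v t y)) x) t) (t : ℝ) :
    ‖v t x‖ = ‖v 0 x‖ := by
  have hderiv (τ : ℝ) : HasDerivAt (fun τ => ‖v τ x‖ ^ 2) 0 τ := by
    refine (hv τ).norm_sq.congr_deriv ?_
    have htangent := inner_realField hV hreal (fun y => clip (v τ y)) x
    have hscale : (max 1 ‖v τ x‖)⁻¹ ≠ 0 := (inv_pos.2 (lt_max_of_lt_left one_pos)).ne'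
    rw [coe_clip, real_inner_smul_left, mul_eq_zero] at htangent
    rw [htangent.resolve_left hscale, mul_zero]
  exact (pow_left_inj₀ (norm_nonneg _) (norm_nonneg _) two_ne_zero).1
    (is_const_of_deriv_eq_zero (fun τ => (hderiv τ).differentiableAt)
      (fun τ => (hderiv τ).deriv) t 0)

theorem exists_isSolutionCurve (hV : V.BoundedBy K) (hreal : V.IsReal) (M₀ : Phase d) :
    ∃ m : ℝ → Phase d, m 0 = M₀ ∧ IsSolutionCurve V m := by
  obtain ⟨v, hv0, hv⟩ := exists_clipped_solution hV M₀
  have hle (t : ℝ) (x : Site d) : ‖v t x‖ ≤ 1 := by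
    rw [norm_eq_of_clipped_solution hV hreal (hv · x), hv0]
    exact mem_closedBall_zero_iff.1 (M₀ x).2
  have hclip (t : ℝ) (x : Site d) : (clip (v t x)).1 = v t x := clip_of_norm_le (hle t x)
  refine ⟨fun t x => clip (v t x), ?_, fun t x i => ?_⟩
  · funext x
    exact Subtype.ext ((hclip 0 x).trans (hv0 x))
  · simp only [coord_eq_coordL, hclip, ← coordL_realField hreal]
    exact (coordL i).hasFDerivAt.comp_hasDerivAt t (hv t x)

theorem exists_isFlow (hV : V.BoundedBy K) (hreal : V.IsReal) : ∃ φ, IsFlow V φ := by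
  choose m h0 hm using exists_isSolutionCurve hV hreal
  exact ⟨fun t M => m M t, fun M => ⟨h0 M, hm M⟩⟩

theorem existsUnique_isClassicalDynamics (hV : V.BoundedBy K) (hreal : V.IsReal) :
    ∃! α, IsClassicalDynamics V α := by
  obtain ⟨φ, hφ⟩ := exists_isFlow hV hreal
  have hα := hφ.isClassicalDynamics hV fun Λ =>
    exists_isFlow (hV.mono (V.norm_restrict_le Λ)) (hreal.restrict Λ)
  exact ⟨_, hα, fun β hβ => hβ.unique hV hα⟩

end Flow

/-! ### Spin matrices -/

section MatrixUnits

variable {m : Type*} [Fintype m] [DecidableEq m] {𝕜 : Type*} [Field 𝕜]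

theorem single_mem_adjoin_diagonal {v : m → 𝕜} (hv : Function.Injective v) (k : m) :
    Matrix.single k k (1 : 𝕜) ∈ Algebra.adjoin 𝕜 {Matrix.diagonal v} := by
  have hbasis : Polynomial.aeval (Matrix.diagonal v) (Lagrange.basis Finset.univ v k) =
      Matrix.single k k (1 : 𝕜) := by
    rw [← Matrix.diagonalAlgHom_apply 𝕜, Polynomial.aeval_algHom_apply,
      Matrix.diagonalAlgHom_apply, ← Matrix.diagonal_single]
    congr 1
    funext l
    rw [Polynomial.aeval_pi_apply₂, Polynomial.coe_aeval_eq_eval]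
    obtain rfl | hlk := eq_or_ne l k
    · rw [Lagrange.eval_basis_self hv.injOn (Finset.mem_univ _), Pi.single_eq_same]
    · rw [Lagrange.eval_basis_of_ne hlk.symm (Finset.mem_univ _), Pi.single_eq_of_ne hlk]
  exact hbasis ▸ Polynomial.aeval_mem_adjoin_singleton 𝕜 _

theorem single_mem_of_apply_ne_zero {𝒜 : Subalgebra 𝕜 (Matrix m m 𝕜)}
    (hdiag : ∀ k, Matrix.single k k (1 : 𝕜) ∈ 𝒜) {a : Matrix m m 𝕜} (ha : a ∈ 𝒜) {k l : m}
    (hkl : a k l ≠ 0) : Matrix.single k l (1 : 𝕜) ∈ 𝒜 := by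
  have h := 𝒜.smul_mem (𝒜.mul_mem (𝒜.mul_mem (hdiag k) ha) (hdiag l)) (a k l)⁻¹
  rwa [Matrix.single_mul_mul_single, one_mul, mul_one, Matrix.smul_single, smul_eq_mul,
    inv_mul_cancel₀ hkl] at h

end MatrixUnits

section SpinMatrix

variable {n : ℕ}

/-- The matrix elements `⟨k| Ŝ_+ |k + 1⟩` of the rescaled ladder operators. -/
noncomputable def ladder (n k : ℕ) : ℝ :=
  Real.sqrt (((k : ℝ) + 1) * ((n : ℝ) - k)) / (Real.sqrt 2 * ((n : ℝ) / 2))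

theorem ladder_mul_self {k : ℕ} (hk : k ≤ n) :
    ladder n k * ladder n k = 2 * ((k + 1) * (n - k)) / (n : ℝ) ^ 2 := by
  have hkn : (0 : ℝ) ≤ n - k := sub_nonneg.2 (by exact_mod_cast hk)
  rw [ladder, ← sq, div_pow, mul_pow, Real.sq_sqrt (by positivity), Real.sq_sqrt zero_le_two]
  ring

theorem ladder_ne_zero {k : ℕ} (hk : k < n) : ladder n k ≠ 0 := by
  have hkn : (0 : ℝ) < n - k := sub_pos.2 (by exact_mod_cast hk)
  have hn : (0 : ℝ) < n := by exact_mod_cast (Nat.zero_le k).trans_lt hk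
  exact (div_pos (Real.sqrt_pos.2 (by positivity)) (by positivity)).ne'

theorem spinMatrix_plus_apply (k l : Fin (n + 1)) :
    spinMatrix n .plus k l = if (l : ℕ) = k + 1 then (ladder n k : ℂ) else 0 := rfl

theorem spinMatrix_minus_apply (k l : Fin (n + 1)) :
    spinMatrix n .minus k l = if (k : ℕ) = l + 1 then (ladder n l : ℂ) else 0 := rfl

theorem spinMatrix_z : spinMatrix n .z =
    Matrix.diagonal fun k : Fin (n + 1) => ((((n : ℝ) / 2 - k) / ((n : ℝ) / 2) : ℝ) : ℂ) := by
  ext k l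
  rw [Matrix.diagonal_apply]
  rfl

theorem star_spinMatrix (i : Idx) : star (spinMatrix n i) = spinMatrix n i.bar := by
  ext k l
  rw [Matrix.star_apply]
  cases i
  · simp only [Idx.bar, spinMatrix_plus_apply, spinMatrix_minus_apply]
    split_ifs <;> simp
  · obtain rfl | hkl := eq_or_ne k l
    · simp [Idx.bar, spinMatrix_z]
    · simp [Idx.bar, spinMatrix_z, hkl, hkl.symm]
  · simp only [Idx.bar, spinMatrix_plus_apply, spinMatrix_minus_apply]
    split_ifs <;> simp

theorem spinMatrix_plus_mul_minus : spinMatrix n .plus * spinMatrix n .minus =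
    Matrix.diagonal fun k : Fin (n + 1) =>
      ((2 * ((k + 1) * (n - k)) / (n : ℝ) ^ 2 : ℝ) : ℂ) := by
  ext k l
  simp only [Matrix.mul_apply, Matrix.diagonal_apply, spinMatrix_plus_apply,
    spinMatrix_minus_apply, ite_mul, zero_mul]
  obtain hk | hk := (Nat.le_of_lt_succ k.2).lt_or_eq
  · rw [Finset.sum_eq_single_of_mem (⟨k + 1, by omega⟩ : Fin (n + 1)) (Finset.mem_univ _)
      fun m _ hm => if_neg fun h => hm (Fin.ext h), if_pos rfl]
    obtain rfl | hkl := eq_or_ne k l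
    · simp [← ladder_mul_self hk.le]
    · simp [hkl, Fin.val_inj]
  · rw [Finset.sum_eq_zero fun m _ => if_neg (by omega)]
    simp [hk]

theorem spinMatrix_minus_mul_plus : spinMatrix n .minus * spinMatrix n .plus =
    Matrix.diagonal fun k : Fin (n + 1) =>
      ((2 * (k * (n - k + 1)) / (n : ℝ) ^ 2 : ℝ) : ℂ) := by
  ext k l
  simp only [Matrix.mul_apply, Matrix.diagonal_apply, spinMatrix_plus_apply,
    spinMatrix_minus_apply, ite_mul, zero_mul]
  obtain hk | ⟨j, hj⟩ : (k : ℕ) = 0 ∨ ∃ j, (k : ℕ) = j + 1 := by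
    cases (k : ℕ) <;> simp
  · rw [Finset.sum_eq_zero fun m _ => if_neg (by omega)]
    simp [hk]
  · rw [Finset.sum_eq_single_of_mem (⟨j, by omega⟩ : Fin (n + 1)) (Finset.mem_univ _)
      fun m _ hm => if_neg fun h => hm (Fin.ext (by simp; omega)), if_pos hj]
    obtain rfl | hkl := eq_or_ne k l
    · have hladder := ladder_mul_self (n := n) (k := j) (by omega)
      simp only [hj, if_true, ← Complex.ofReal_mul, hladder]
      push_cast
      ring
    · have hlk : ¬ (l : ℕ) = j + 1 := by omega
      simp [hkl, hlk]

theorem spinMatrix_plus_commutator_minus :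
    spinMatrix n .plus * spinMatrix n .minus - spinMatrix n .minus * spinMatrix n .plus =
      ((n : ℂ) / 2)⁻¹ • spinMatrix n .z := by
  rw [spinMatrix_plus_mul_minus, spinMatrix_minus_mul_plus, spinMatrix_z, Matrix.diagonal_sub,
    ← Matrix.diagonal_smul]
  congr 1
  funext k
  simp only [Pi.smul_apply, smul_eq_mul]
  push_cast
  ring

theorem spinMatrix_z_commutator_plus (hn : n ≠ 0) :
    spinMatrix n .z * spinMatrix n .plus - spinMatrix n .plus * spinMatrix n .z =
      ((n : ℂ) / 2)⁻¹ • spinMatrix n .plus := by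
  have hn' : (n : ℂ) ≠ 0 := Nat.cast_ne_zero.2 hn
  ext k l
  rw [spinMatrix_z, Matrix.sub_apply, Matrix.diagonal_mul, Matrix.mul_diagonal, Matrix.smul_apply,
    spinMatrix_plus_apply, smul_eq_mul]
  split_ifs with h
  · rw [h]
    push_cast
    field_simp
    ring
  · simp

theorem spinMatrix_minus_commutator_z (hn : n ≠ 0) :
    spinMatrix n .minus * spinMatrix n .z - spinMatrix n .z * spinMatrix n .minus =
      ((n : ℂ) / 2)⁻¹ • spinMatrix n .minus := by
  simpa [star_spinMatrix, Idx.bar] using congr_arg star (spinMatrix_z_commutator_plus hn)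

theorem spinMatrix_commutator (hn : n ≠ 0) (i j : Idx) :
    spinMatrix n i * spinMatrix n j - spinMatrix n j * spinMatrix n i =
      ((n : ℂ) / 2)⁻¹ • ∑ k : Idx, (eps i j k : ℂ) • spinMatrix n k := by
  have hpm := spinMatrix_plus_commutator_minus (n := n)
  have hzp := spinMatrix_z_commutator_plus hn
  have hmz := spinMatrix_minus_commutator_z hn
  rw [sum_Idx]
  cases i <;> cases j <;> simp only [eps, Int.cast_zero, Int.cast_one, Int.cast_neg, zero_smul,
    one_smul, neg_smul, smul_neg, add_zero, zero_add, smul_zero, sub_self, hpm, hzp, hmz] <;>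
    rw [← neg_sub] <;> simp only [hpm, hzp, hmz]

theorem adjoin_range_spinMatrix (hn : n ≠ 0) :
    Algebra.adjoin ℂ (Set.range (spinMatrix n)) = ⊤ := by
  set 𝒜 := Algebra.adjoin ℂ (Set.range (spinMatrix n))
  have hspin (i : Idx) : spinMatrix n i ∈ 𝒜 := Algebra.subset_adjoin ⟨i, rfl⟩
  have hn' : (n : ℝ) ≠ 0 := Nat.cast_ne_zero.2 hn
  have hdiag (k : Fin (n + 1)) : Matrix.single k k (1 : ℂ) ∈ 𝒜 := by
    have hz := Set.singleton_subset_iff.2 (Set.mem_range_self (f := spinMatrix n) .z)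
    rw [spinMatrix_z] at hz
    refine Algebra.adjoin_mono hz (single_mem_adjoin_diagonal (fun k l hkl => ?_) k)
    have hkl' : (k : ℝ) = l := by
      have := Complex.ofReal_injective hkl
      field_simp at this
      linarith
    exact Fin.ext (by exact_mod_cast hkl')
  have hzero (k : Fin (n + 1)) :
      Matrix.single 0 k (1 : ℂ) ∈ 𝒜 ∧ Matrix.single k 0 (1 : ℂ) ∈ 𝒜 := by
    induction k using Fin.induction with
    | zero => exact ⟨hdiag 0, hdiag 0⟩
    | succ k ih =>
      have hladder : (ladder n k : ℂ) ≠ 0 := Complex.ofReal_ne_zero.2 (ladder_ne_zero k.2)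
      have hup := 𝒜.mul_mem ih.1 (single_mem_of_apply_ne_zero hdiag (hspin .plus)
        (k := k.castSucc) (l := k.succ) (by simpa [spinMatrix_plus_apply] using hladder))
      have hdown := 𝒜.mul_mem (single_mem_of_apply_ne_zero hdiag (hspin .minus)
        (k := k.succ) (l := k.castSucc) (by simpa [spinMatrix_minus_apply] using hladder)) ih.2
      rw [Matrix.single_mul_single_same, one_mul] at hup hdown
      exact ⟨hup, hdown⟩
  refine eq_top_iff.2 fun a _ => ?_
  induction a using Matrix.induction_on with
  | h_add a b ha hb => exact 𝒜.add_mem (ha trivial) (hb trivial)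
  | h_std_basis k l c =>
    have h := 𝒜.smul_mem (𝒜.mul_mem (hzero k).2 (hzero l).1) c
    rwa [Matrix.single_mul_single_same, one_mul, Matrix.smul_single, smul_eq_mul, mul_one] at h

end SpinMatrix

/-! ### Quantum spins -/

section SiteOp

variable {d n : ℕ} (x : Site d)

theorem siteOp_apply (a : Matrix (Fin (n + 1)) (Fin (n + 1)) ℂ) (ψ : Hilb d n)
    (η : Config d n) : siteOp x a ψ η = ∑ k, a (η x) k * ψ (Function.update η x k) := rfl

theorem siteOp_single_apply (j k : Fin (n + 1)) (c : ℂ) (ψ : Hilb d n) (η : Config d n) :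
    siteOp x (Matrix.single j k c) ψ η =
      if η x = j then c * ψ (Function.update η x k) else 0 := by
  simp only [siteOp_apply, Matrix.single_apply, ite_and, ite_mul, zero_mul, eq_comm (a := j)]
  split_ifs <;> simp

theorem siteOp_diagonal_apply (v : Fin (n + 1) → ℂ) (ψ : Hilb d n) (η : Config d n) :
    siteOp x (Matrix.diagonal v) ψ η = v (η x) * ψ η := by
  simp [siteOp_apply, Matrix.diagonal_apply]

theorem siteOp_add (a b : Matrix (Fin (n + 1)) (Fin (n + 1)) ℂ) :
    siteOp x (a + b) = siteOp x a + siteOp x b := by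
  ext ψ η
  change siteOp x (a + b) ψ η = siteOp x a ψ η + siteOp x b ψ η
  simp only [siteOp_apply, Matrix.add_apply, add_mul, Finset.sum_add_distrib]

theorem siteOp_mul (a b : Matrix (Fin (n + 1)) (Fin (n + 1)) ℂ) :
    siteOp x (a * b) = siteOp x a * siteOp x b := by
  ext ψ η
  change siteOp x (a * b) ψ η = siteOp x a (siteOp x b ψ) η
  simp only [siteOp_apply, Matrix.mul_apply, Function.update_self, Function.update_idem,
    Finset.sum_mul, Finset.mul_sum]
  rw [Finset.sum_comm]
  simp only [mul_assoc]

theorem siteOp_smul_one (c : ℂ) :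
    siteOp x (c • 1 : Matrix (Fin (n + 1)) (Fin (n + 1)) ℂ) = c • 1 := by
  ext ψ η
  rw [Matrix.smul_one_eq_diagonal, siteOp_diagonal_apply]
  rfl

theorem star_siteOp (a : Matrix (Fin (n + 1)) (Fin (n + 1)) ℂ) :
    star (siteOp x a) = siteOp x (star a) := by
  induction a using Matrix.induction_on with
  | h_add a b ha hb => rw [siteOp_add, star_add, ha, hb, star_add, siteOp_add]
  | h_std_basis k j c =>
    rw [Matrix.star_eq_conjTranspose, Matrix.conjTranspose_single, eq_comm,
      ContinuousLinearMap.star_eq_adjoint, ContinuousLinearMap.eq_adjoint_iff]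
    intro ψ χ
    rw [lp.inner_eq_tsum, lp.inner_eq_tsum, ← (sitePerm x (Equiv.swap k j)).tsum_eq]
    refine tsum_congr fun η => ?_
    have hperm : sitePerm x (Equiv.swap k j) η x = j ↔ η x = k := by
      simp [sitePerm, Equiv.swap_apply_eq_iff]
    rw [siteOp_single_apply, siteOp_single_apply]
    simp only [hperm]
    split_ifs with hη
    · subst hη
      simp only [sitePerm_swap, Function.update_idem, Function.update_eq_self, RCLike.inner_apply,
        map_mul, RCLike.star_def, starRingEnd_self_apply]
      ring
    · simp

/-- The operators at the site `x`. -/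
noncomputable def siteHom :
    Matrix (Fin (n + 1)) (Fin (n + 1)) ℂ →⋆ₐ[ℂ] (Hilb d n →L[ℂ] Hilb d n) where
  toFun := siteOp x
  map_one' := by simpa using siteOp_smul_one (n := n) x 1
  map_mul' := siteOp_mul x
  map_zero' := by simpa using siteOp_smul_one (n := n) x 0
  map_add' := siteOp_add x
  commutes' c := by simpa [Algebra.algebraMap_eq_smul_one] using siteOp_smul_one (n := n) x c
  map_star' a := (star_siteOp x a).symm

variable {x} in
theorem commute_siteOp {y : Site d} (hxy : x ≠ y) (a b : Matrix (Fin (n + 1)) (Fin (n + 1)) ℂ) :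
    Commute (siteOp x a) (siteOp y b) := by
  ext ψ η
  change siteOp x a (siteOp y b ψ) η = siteOp y b (siteOp x a ψ) η
  simp only [siteOp_apply, Function.update_of_ne hxy, Function.update_of_ne hxy.symm,
    Finset.mul_sum]
  rw [Finset.sum_comm]
  refine Finset.sum_congr rfl fun k _ => Finset.sum_congr rfl fun l _ => ?_
  rw [Function.update_comm hxy]
  ring

theorem norm_siteOp_diagonal_le {v : Fin (n + 1) → ℂ} {C : ℝ} (hC : 0 ≤ C)
    (hv : ∀ k, ‖v k‖ ≤ C) : ‖siteOp (n := n) x (Matrix.diagonal v)‖ ≤ C := by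
  refine ContinuousLinearMap.opNorm_le_bound _ hC fun ψ => le_of_sq_le_sq ?_ (by positivity)
  rw [mul_pow, hilb_norm_sq, hilb_norm_sq, ← tsum_mul_left]
  refine Summable.tsum_le_tsum (fun η => ?_) (hilb_summable _) ((hilb_summable ψ).mul_left _)
  rw [siteOp_diagonal_apply, norm_mul, mul_pow]
  gcongr
  exact hv _

end SiteOp

theorem star_prod_map_of_commute {ι R : Type*} [Monoid R] [StarMul R] {f : ι → R}
    (hf : ∀ x y, Commute (f x) (f y)) (l : List ι) :
    star (l.map f).prod = (l.map fun x => star (f x)).prod := by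
  induction l with
  | nil => simp
  | cons x l ih =>
    rw [List.map_cons, List.prod_cons, star_mul, ih, List.map_cons, List.prod_cons]
    exact Commute.list_prod_left _ _ (List.forall_mem_map.2 fun y _ => (hf y x).star_star)

section QuantumSpin

variable {d n : ℕ}

theorem star_quantumSpin (p : Letter d) :
    star (quantumSpin n p) = quantumSpin n (p.1, p.2.bar) := by
  apply Subtype.ext
  change star (siteOp p.1 (spinMatrix n p.2)) = siteOp p.1 (spinMatrix n p.2.bar)
  rw [star_siteOp, star_spinMatrix]

theorem norm_quantumSpin_plus_le (x : Site d) : ‖quantumSpin n (x, .plus)‖ ≤ √2 := by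
  refine Real.le_sqrt_of_sq_le ?_
  rw [sq, ← CStarRing.norm_star_mul_self, star_quantumSpin]
  change ‖siteOp x (spinMatrix n .minus) * siteOp x (spinMatrix n .plus)‖ ≤ 2
  rw [← siteOp_mul, spinMatrix_minus_mul_plus]
  refine norm_siteOp_diagonal_le x zero_le_two fun k => ?_
  have hk : (k : ℝ) ≤ n := by exact_mod_cast Nat.le_of_lt_succ k.2
  have hkk : (k : ℝ) ≤ k * k := by exact_mod_cast Nat.le_mul_self _
  have hpos : 0 ≤ (k : ℝ) * (n - k + 1) := mul_nonneg (by positivity) (by linarith)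
  rw [Complex.norm_real,
    Real.norm_of_nonneg (div_nonneg (mul_nonneg zero_le_two hpos) (sq_nonneg _))]
  refine div_le_of_le_mul₀ (by positivity) zero_le_two ?_
  nlinarith [mul_nonneg (sub_nonneg.2 hk) (Nat.cast_nonneg (α := ℝ) k)]

theorem norm_quantumSpin_z_le (x : Site d) : ‖quantumSpin n (x, .z)‖ ≤ 1 := by
  change ‖siteOp x (spinMatrix n .z)‖ ≤ 1
  rw [spinMatrix_z]
  refine norm_siteOp_diagonal_le x zero_le_one fun k => ?_
  have hk : (k : ℝ) ≤ n := by exact_mod_cast Nat.le_of_lt_succ k.2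
  rw [Complex.norm_real, norm_div, Real.norm_of_nonneg (by positivity : 0 ≤ (n : ℝ) / 2),
    Real.norm_eq_abs]
  refine div_le_one_of_le₀ (abs_le.2 ⟨?_, ?_⟩) (by positivity) <;>
    linarith [Nat.cast_nonneg (α := ℝ) (k : ℕ)]

theorem norm_quantumSpin_le (p : Letter d) : ‖quantumSpin n p‖ ≤ Real.exp (1 / 2) := by
  have hsqrt : √2 ≤ Real.exp (1 / 2) := by
    rw [Real.exp_half]
    exact Real.sqrt_le_sqrt (by linarith [Real.add_one_le_exp 1])
  obtain ⟨x, i⟩ := p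
  cases i with
  | plus => exact (norm_quantumSpin_plus_le x).trans hsqrt
  | z => exact (norm_quantumSpin_z_le x).trans (Real.one_le_exp (by norm_num))
  | minus =>
    rw [← norm_star, star_quantumSpin]
    exact (norm_quantumSpin_plus_le x).trans hsqrt

instance : NormOneClass (QuantumAlg d n) where
  norm_one := by
    classical
    have : Nontrivial (Hilb d n) := ⟨lp.single 2 0 1, 0, fun h => by
      simpa using congr_arg (fun ψ : Hilb d n => ψ 0) h⟩
    exact ContinuousLinearMap.norm_id

theorem norm_lift_quantumSpin_word_le (w : List (Letter d)) :
    ‖FreeAlgebra.lift ℂ (quantumSpin n) (word w)‖ ≤ Real.exp (1 / 2 * w.length) := by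
  rw [mul_comm, Real.exp_nat_mul]
  exact norm_lift_word_le norm_quantumSpin_le w

theorem quantumSpin_commutator (hn : n ≠ 0) (a b : Letter d) :
    quantumSpin n a * quantumSpin n b - quantumSpin n b * quantumSpin n a =
      (Complex.I * ((n : ℂ) / 2))⁻¹ • FreeAlgebra.lift ℂ (quantumSpin n) (spinBracket a b) := by
  obtain ⟨x, i⟩ := a
  obtain ⟨y, j⟩ := b
  apply Subtype.ext
  obtain rfl | hxy := eq_or_ne x y
  · have h := congr_arg (siteHom (d := d) x) (spinMatrix_commutator hn i j)
    rw [map_smul, map_sub, map_mul, map_mul, map_sum] at h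
    simp only [map_smul] at h
    refine h.trans ?_
    simp only [spinBracket, if_true, map_sum, map_smul, FreeAlgebra.lift_ι_apply, mul_smul,
      ← Finset.smul_sum, mul_inv_rev, inv_smul_smul₀ Complex.I_ne_zero]
    push_cast
    rfl
  · rw [spinBracket, if_neg hxy, map_zero, smul_zero]
    exact sub_eq_zero.2 (commute_siteOp hxy _ _).eq

theorem quantizeMonomial_eq (α : MultiIndex d) :
    quantizeMonomial n α = FreeAlgebra.lift ℂ (quantumSpin n) (word (normalWord α)) := by
  have hpart (i : Idx) : ((wordPart i α).map (quantumSpin n)).prod = spinPower n i α := by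
    rw [wordPart, spinPower]
    induction (α.support.image Prod.fst).toList with
    | nil => rfl
    | cons x l ih => simp [ih]
  rw [lift_word, normalWord, List.map_append, List.map_append, List.prod_append, List.prod_append,
    hpart, hpart, hpart, quantizeMonomial]

theorem lift_monomialBracket (hn : n ≠ 0) (α : MultiIndex d) (B : FreeAlgebra ℂ (Letter d)) :
    FreeAlgebra.lift ℂ (quantumSpin n) (monomialBracket α B) = (Complex.I * ((n : ℂ) / 2)) •
      (quantizeMonomial n α * FreeAlgebra.lift ℂ (quantumSpin n) B -
        FreeAlgebra.lift ℂ (quantumSpin n) B * quantizeMonomial n α) := by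
  have hs : Complex.I * ((n : ℂ) / 2) ≠ 0 := by simp [hn]
  rw [quantizeMonomial_eq, commutator_lift (quantumSpin_commutator hn), smul_inv_smul₀ hs,
    monomialBracket]

theorem star_spinPower (i : Idx) (α : MultiIndex d) :
    star (spinPower n i α) = spinPower n i.bar α.bar := by
  have hcomm (x y : Site d) : Commute (quantumSpin n (x, i)) (quantumSpin n (y, i)) := by
    obtain rfl | hxy := eq_or_ne x y
    · rfl
    · exact Subtype.ext (commute_siteOp hxy _ _).eq
  have hsites : α.bar.support.image Prod.fst = α.support.image Prod.fst := by
    ext x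
    simp only [Finset.mem_image, Finsupp.mem_support_iff, Prod.exists, MultiIndex.bar_apply,
      exists_and_right, exists_eq_right]
    exact ⟨fun ⟨i, hi⟩ => ⟨_, hi⟩, fun ⟨i, hi⟩ => ⟨i.bar, by rwa [Idx.bar_involutive]⟩⟩
  rw [spinPower, spinPower, hsites,
    star_prod_map_of_commute fun x y => (hcomm x y).pow_pow _ _]
  simp only [star_pow, star_quantumSpin, MultiIndex.bar_apply, Idx.bar_involutive i]

theorem star_quantizeMonomial (α : MultiIndex d) :
    star (quantizeMonomial n α) = quantizeMonomial n α.bar := by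
  rw [quantizeMonomial, quantizeMonomial, star_mul, star_mul, star_spinPower, star_spinPower,
    star_spinPower, mul_assoc]
  rfl

theorem localAlg_mono {Λ Λ' : Finset (Site d)} (h : Λ ⊆ Λ') : localAlg d n Λ ≤ localAlg d n Λ' :=
  StarAlgebra.adjoin_mono fun _ ⟨x, hx, a, ha⟩ => ⟨x, h hx, a, ha⟩

theorem siteOp_mem_localAlg {Λ : Finset (Site d)} {x : Site d} (hx : x ∈ Λ)
    (a : Matrix (Fin (n + 1)) (Fin (n + 1)) ℂ) : siteOp x a ∈ localAlg d n Λ :=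
  StarAlgebra.subset_adjoin ℂ _ ⟨x, hx, a, rfl⟩

theorem exists_lift_mem_localAlg (B : FreeAlgebra ℂ (Letter d)) : ∃ Λ : Finset (Site d),
    (FreeAlgebra.lift ℂ (quantumSpin n) B : Hilb d n →L[ℂ] Hilb d n) ∈ localAlg d n Λ := by
  classical
  induction B using FreeAlgebra.induction with
  | grade0 c => exact ⟨∅, by rw [AlgHom.commutes]; exact (localAlg d n ∅).algebraMap_mem c⟩
  | grade1 p =>
    rw [FreeAlgebra.lift_ι_apply]
    exact ⟨{p.1}, siteOp_mem_localAlg (Finset.mem_singleton_self _) _⟩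
  | mul A B hA hB =>
    obtain ⟨Λ₁, h₁⟩ := hA
    obtain ⟨Λ₂, h₂⟩ := hB
    rw [map_mul]
    exact ⟨Λ₁ ∪ Λ₂, mul_mem (localAlg_mono Finset.subset_union_left h₁)
      (localAlg_mono Finset.subset_union_right h₂)⟩
  | add A B hA hB =>
    obtain ⟨Λ₁, h₁⟩ := hA
    obtain ⟨Λ₂, h₂⟩ := hB
    rw [map_add]
    exact ⟨Λ₁ ∪ Λ₂, add_mem (localAlg_mono Finset.subset_union_left h₁)
      (localAlg_mono Finset.subset_union_right h₂)⟩

theorem siteOp_mem_adjoin_range_quantumSpin (hn : n ≠ 0) (x : Site d)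
    (a : Matrix (Fin (n + 1)) (Fin (n + 1)) ℂ) :
    siteOp x a ∈ Algebra.adjoin ℂ
      (Set.range fun p : Letter d => (quantumSpin n p : Hilb d n →L[ℂ] Hilb d n)) := by
  have hmap : siteOp x a ∈
      (Algebra.adjoin ℂ (Set.range (spinMatrix n))).map (siteHom (d := d) x).toAlgHom :=
    Subalgebra.mem_map.2 ⟨a, by rw [adjoin_range_spinMatrix hn]; exact Algebra.mem_top, rfl⟩
  rw [AlgHom.map_adjoin, ← Set.range_comp] at hmap
  refine Algebra.adjoin_mono ?_ hmap
  rintro _ ⟨i, rfl⟩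
  exact ⟨(x, i), rfl⟩

theorem dense_range_lift_quantumSpin (hn : n ≠ 0) :
    DenseRange (FreeAlgebra.lift ℂ (quantumSpin n : Letter d → QuantumAlg d n)) := by
  set s : Letter d → (Hilb d n →L[ℂ] Hilb d n) := fun p => quantumSpin n p
  have hstar (p : Letter d) : star (s p) ∈ Set.range s :=
    ⟨_, congr_arg Subtype.val (star_quantumSpin p).symm⟩
  have hle : (⨆ Λ : Finset (Site d), localAlg d n Λ) ≤ StarAlgebra.adjoin ℂ (Set.range s) := by
    refine iSup_le fun Λ => StarAlgebra.adjoin_le ?_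
    rintro _ ⟨x, -, a, rfl⟩
    exact Algebra.adjoin_mono Set.subset_union_left (siteOp_mem_adjoin_range_quantumSpin hn x a)
  have hcoe : (quasiLocal d n).subtype.toAlgHom.comp (FreeAlgebra.lift ℂ (quantumSpin n)) =
      FreeAlgebra.lift ℂ s := by
    ext p
    simp [s]
  intro a
  rw [closure_subtype]
  refine closure_mono (fun T hT => ?_) a.2
  obtain ⟨B, rfl⟩ := adjoin_range_le_range_lift hstar (hle hT)
  exact ⟨_, ⟨B, rfl⟩, DFunLike.congr_fun hcoe B⟩

end QuantumSpin

/-! ### Heisenberg dynamics -/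

section Heisenberg

variable {𝔅 : Type*} [CStarAlgebra 𝔅]

/-- The Heisenberg evolution `a ↦ exp(itH) a exp(-itH)`. -/
noncomputable def heisenberg (H : selfAdjoint 𝔅) (t : ℝ) : 𝔅 ≃⋆ₐ[ℂ] 𝔅 :=
  Unitary.conjStarAlgAut ℂ 𝔅 (selfAdjoint.expUnitary (t • H))

theorem heisenberg_zero (H : selfAdjoint 𝔅) (a : 𝔅) : heisenberg H 0 a = a := by
  simp [heisenberg]

theorem heisenberg_add (H : selfAdjoint 𝔅) (t u : ℝ) (a : 𝔅) :
    heisenberg H (t + u) a = heisenberg H t (heisenberg H u a) := by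
  have hcomm : Commute ((t • H : selfAdjoint 𝔅) : 𝔅) ((u • H : selfAdjoint 𝔅) : 𝔅) :=
    ((Commute.refl (H : 𝔅)).smul_left t).smul_right u
  rw [heisenberg, add_smul, hcomm.expUnitary_add, Unitary.conjStarAlgAut_mul_apply]
  rfl

theorem hasDerivAt_heisenberg (H : selfAdjoint 𝔅) (t : ℝ) (a : 𝔅) :
    HasDerivAt (fun τ => heisenberg H τ a)
      (heisenberg H t (Complex.I • ((H : 𝔅) * a - a * H))) t := by
  set Y : 𝔅 := Complex.I • (H : 𝔅) with hY
  have heq (τ : ℝ) (b : 𝔅) :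
      heisenberg H τ b = NormedSpace.exp (τ • Y) * b * NormedSpace.exp (τ • -Y) := by
    have hstar : star (τ • Y) = τ • -Y := by
      simp [hY, star_smul, H.2.star_eq]
    rw [heisenberg, Unitary.conjStarAlgAut_apply, selfAdjoint.expUnitary_coe,
      selfAdjoint.val_smul, smul_comm, NormedSpace.star_exp, hstar]
  simp only [heq]
  refine (((hasDerivAt_exp_smul_const Y t).mul_const a).mul
    (hasDerivAt_exp_smul_const' (-Y) t)).congr_deriv ?_
  have hcomm : Complex.I • ((H : 𝔅) * a - a * H) = Y * a - a * Y := by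
    rw [smul_sub, hY, smul_mul_assoc, mul_smul_comm]
  rw [hcomm]
  noncomm_ring

/-- The linear map that sends a noncommutative polynomial in the letters to its value in the
Heisenberg picture at time `t`, when the letters stand for the operators `s`. -/
noncomputable def heisenbergLift {L : Type*} (H : selfAdjoint 𝔅) (s : L → 𝔅) (t : ℝ) :
    FreeAlgebra ℂ L →ₗ[ℂ] 𝔅 :=
  (heisenberg H t).toAlgEquiv.toLinearMap ∘ₗ (FreeAlgebra.lift ℂ s).toLinearMap

theorem heisenbergLift_apply {L : Type*} (H : selfAdjoint 𝔅) (s : L → 𝔅) (t : ℝ)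
    (B : FreeAlgebra ℂ L) : heisenbergLift H s t B = heisenberg H t (FreeAlgebra.lift ℂ s B) := rfl

theorem isWordSolution_heisenbergLift {d : ℕ} {V : Potential d} {H : selfAdjoint 𝔅}
    {s : Letter d → 𝔅} {h : MultiIndex d → 𝔅}
    (hs : ∀ w, ‖FreeAlgebra.lift ℂ s (word w)‖ ≤ Real.exp (1 / 2 * w.length))
    (hbracket : ∀ α B, FreeAlgebra.lift ℂ s (monomialBracket α B) =
      Complex.I • (h α * FreeAlgebra.lift ℂ s B - FreeAlgebra.lift ℂ s B * h α))
    (hH : HasSum (fun α => V α • h α) (H : 𝔅)) :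
    IsWordSolution V (heisenbergLift H s) where
  norm_word_le t w := (StarAlgEquiv.norm_map (heisenberg H t) _).trans_le (hs w)
  hasDerivAt_word t w := by
    refine (hasDerivAt_heisenberg H t (FreeAlgebra.lift ℂ s (word w))).congr_deriv ?_
    have hsum := ((hH.mul_right (FreeAlgebra.lift ℂ s (word w))).sub
      (hH.mul_left (FreeAlgebra.lift ℂ s (word w)))).const_smul Complex.I
    refine (hsum.map (heisenberg H t) (StarAlgEquiv.isometry _).continuous).tsum_eq.symm.trans
      (tsum_congr fun α => ?_)
    rw [heisenbergLift_apply, hbracket, Function.comp_apply,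
      smul_mul_assoc, mul_smul_comm, ← smul_sub, smul_comm]
    exact map_smul (heisenberg H t) _ _

end Heisenberg

section LimitDynamics

theorem exists_tendsto_of_forall_eventually_dist_le {𝔅 ι : Type*} [PseudoMetricSpace 𝔅]
    [CompleteSpace 𝔅] {l : Filter ι} [l.NeBot] {f : ι → 𝔅}
    (h : ∀ ε > 0, ∃ b, ∀ᶠ i in l, dist (f i) b ≤ ε) : ∃ b, Tendsto f l (𝓝 b) := by
  refine cauchy_map_iff_exists_tendsto.1 (Metric.cauchy_iff.2 ⟨inferInstance, fun ε hε => ?_⟩)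
  obtain ⟨b, hb⟩ := h (ε / 3) (by positivity)
  refine ⟨Metric.closedBall b (ε / 3), hb, fun x hx y hy => ?_⟩
  have := dist_triangle_right x y b
  rw [Metric.mem_closedBall] at hx hy
  linarith

theorem exists_tendsto_of_dense {𝔅 ι : Type*} [PseudoMetricSpace 𝔅] [CompleteSpace 𝔅]
    {l : Filter ι} [l.NeBot] {T : ι → 𝔅 → 𝔅} (hT : ∀ i, LipschitzWith 1 (T i)) {S : Set 𝔅}
    (hS : Dense S) (h : ∀ a ∈ S, ∀ ε > 0, ∃ b, ∀ᶠ i in l, dist (T i a) b ≤ ε) (a : 𝔅) :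
    ∃ b, Tendsto (fun i => T i a) l (𝓝 b) := by
  refine exists_tendsto_of_forall_eventually_dist_le fun ε hε => ?_
  obtain ⟨a', ha', haa'⟩ := hS.exists_dist_lt a (half_pos hε)
  obtain ⟨b, hb⟩ := h a' ha' (ε / 2) (half_pos hε)
  refine ⟨b, hb.mono fun i hi => ?_⟩
  have hlip := (hT i).dist_le_mul a a'
  rw [NNReal.coe_one, one_mul] at hlip
  linarith [dist_triangle (T i a) (T i a') b]

variable {𝔅 ι : Type*} [CStarAlgebra 𝔅] {l : Filter ι} [l.NeBot]
  {β : ι → ℝ → 𝔅 ≃⋆ₐ[ℂ] 𝔅}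

theorem exists_automorphism_group_of_tendsto (hzero : ∀ i a, β i 0 a = a)
    (hadd : ∀ i t u a, β i (t + u) a = β i t (β i u a)) {T : ℝ → 𝔅 → 𝔅}
    (hT : ∀ t a, Tendsto (fun i => β i t a) l (𝓝 (T t a))) :
    ∃ α : ℝ → 𝔅 ≃⋆ₐ[ℂ] 𝔅, (∀ t a, α t a = T t a) ∧ (∀ a, α 0 a = a) ∧
      ∀ t u a, α (t + u) a = α t (α u a) := by
  have hT_zero (a : 𝔅) : T 0 a = a :=
    tendsto_nhds_unique (hT 0 a) (by simpa only [hzero] using tendsto_const_nhds)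
  have hT_add (t u : ℝ) (a : 𝔅) : T (t + u) a = T t (T u a) := by
    have herr : Tendsto (fun i => β i t (β i u a - T u a)) l (𝓝 0) := by
      refine squeeze_zero_norm (fun i => ?_) (tendsto_iff_norm_sub_tendsto_zero.1 (hT u a))
      rw [StarAlgEquiv.norm_map]
    refine tendsto_nhds_unique (hT (t + u) a) ?_
    simpa only [map_sub, sub_add_cancel, zero_add, hadd] using herr.add (hT t (T u a))
  refine ⟨fun t =>
    { toFun := T t
      invFun := T (-t)
      left_inv a := by rw [← hT_add, neg_add_cancel, hT_zero]
      right_inv a := by rw [← hT_add, add_neg_cancel, hT_zero]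
      map_mul' a b := tendsto_nhds_unique (hT t (a * b))
        (by simpa only [map_mul] using (hT t a).mul (hT t b))
      map_add' a b := tendsto_nhds_unique (hT t (a + b))
        (by simpa only [map_add] using (hT t a).add (hT t b))
      map_star' a := tendsto_nhds_unique (hT t (star a))
        (by simpa only [map_star] using (hT t a).star)
      map_smul' c a := tendsto_nhds_unique (hT t (c • a))
        (by simpa only [map_smul] using (hT t a).const_smul c) },
    fun _ _ => rfl, hT_zero, hT_add⟩

theorem exists_limit_dynamics (hzero : ∀ i a, β i 0 a = a)
    (hadd : ∀ i t u a, β i (t + u) a = β i t (β i u a)) {S : Set 𝔅} (hS : Dense S)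
    (hlim : ∀ a ∈ S, ∀ t, ∀ ε > 0, ∃ b, ∀ᶠ i in l, ‖β i t a - b‖ ≤ ε)
    (hlip : ∀ a ∈ S, ∃ C, ∀ i t u, ‖β i t a - β i u a‖ ≤ C * |t - u|) :
    ∃ α : ℝ → 𝔅 ≃⋆ₐ[ℂ] 𝔅, (∀ a, α 0 a = a) ∧ (∀ t u a, α (t + u) a = α t (α u a)) ∧
      (∀ a, Continuous fun t => α t a) ∧ ∀ t a, Tendsto (fun i => β i t a) l (𝓝 (α t a)) := by
  have hlimit (t : ℝ) (a : 𝔅) : ∃ b, Tendsto (fun i => β i t a) l (𝓝 b) :=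
    exists_tendsto_of_dense (T := fun i => β i t)
      (fun i => (StarAlgEquiv.isometry (β i t)).lipschitz) hS
      (fun a ha ε hε => by simpa only [dist_eq_norm] using hlim a ha t ε hε) a
  choose T hT using hlimit
  obtain ⟨α, hα, hα_zero, hα_add⟩ := exists_automorphism_group_of_tendsto hzero hadd hT
  simp only [← hα] at hT
  refine ⟨α, hα_zero, hα_add, continuous_of_dense (T := fun t => α t)
    (fun t => (StarAlgEquiv.isometry (α t)).lipschitz) hS fun a ha => ?_, hT⟩
  obtain ⟨C, hC⟩ := hlip a ha
  refine (LipschitzWith.of_dist_le_mul (K := C.toNNReal) fun t u => ?_).continuous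
  rw [dist_eq_norm, Real.dist_eq]
  refine (le_of_tendsto ((hT t a).sub (hT u a)).norm (.of_forall fun i => hC i t u)).trans ?_
  gcongr
  exact Real.le_coe_toNNReal C

end LimitDynamics

/-! ### Quantum dynamics -/

section Quantum

variable {d n : ℕ} {V : Potential d} {K : ℝ}

instance isClosed_quasiLocal (d n : ℕ) :
    IsClosed (quasiLocal d n : Set (Hilb d n →L[ℂ] Hilb d n)) :=
  StarSubalgebra.isClosed_topologicalClosure _

theorem MultiIndex.one_le_at {α : MultiIndex d} {p : Letter d} (hp : p ∈ α.support) :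
    1 ≤ α.at p.1 :=
  (Nat.one_le_iff_ne_zero.2 (Finsupp.mem_support_iff.1 hp)).trans
    (Finset.single_le_sum (f := fun i => α (p.1, i)) (fun _ _ => Nat.zero_le _)
      (Finset.mem_univ p.2))

theorem Potential.BoundedBy.summable_restrict (hV : V.BoundedBy K) (Λ : Finset (Site d)) :
    Summable fun α => ‖V.restrict Λ α‖ * Real.exp (α.degree : ℝ) := by
  classical
  have hsite (x : Site d) :
      Summable fun α => (α.at x : ℝ) * ‖V α‖ * Real.exp (α.degree : ℝ) :=
    summable_of_sum_le (fun α => by positivity) (hV x)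
  refine Summable.of_nonneg_of_le (fun α => by positivity) (fun α => ?_)
    ((hasSum_ite_eq (0 : MultiIndex d) ‖V 0‖).summable.add
      (summable_sum (s := Λ) fun x _ => hsite x))
  have hnonneg (x : Site d) : 0 ≤ (α.at x : ℝ) * ‖V α‖ * Real.exp (α.degree : ℝ) := by positivity
  obtain rfl | hα := eq_or_ne α 0
  · rw [if_pos rfl]
    refine le_add_of_le_of_nonneg ?_ (Finset.sum_nonneg fun x _ => hnonneg x)
    simpa using V.norm_restrict_le Λ 0
  rw [if_neg hα, zero_add]
  by_cases hsupp : ∀ p ∈ α.support, p.1 ∈ Λ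
  · obtain ⟨p, hp⟩ := Finsupp.support_nonempty_iff.2 hα
    have hat : (1 : ℝ) ≤ α.at p.1 := by exact_mod_cast MultiIndex.one_le_at hp
    refine le_trans ?_ (Finset.single_le_sum (fun x _ => hnonneg x) (hsupp p hp))
    gcongr
    exact (V.norm_restrict_le Λ α).trans (le_mul_of_one_le_left (norm_nonneg _) hat)
  · rw [Potential.restrict, if_neg hsupp, norm_zero, zero_mul]
    exact Finset.sum_nonneg fun x _ => hnonneg x

theorem hasSum_hamiltonian (hV : V.BoundedBy K) (Λ : Finset (Site d)) :
    HasSum (fun α => V.restrict Λ α • quantizeMonomial n α) (hamiltonian V n Λ) := by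
  refine (Summable.of_norm_bounded (hV.summable_restrict Λ) fun α => ?_).hasSum
  rw [norm_smul, quantizeMonomial_eq]
  gcongr
  refine (norm_lift_quantumSpin_word_le _).trans (Real.exp_le_exp.2 ?_)
  rw [length_normalWord]
  linarith [Nat.cast_nonneg (α := ℝ) α.degree]

theorem isSelfAdjoint_hamiltonian (hreal : V.IsReal) (Λ : Finset (Site d)) :
    IsSelfAdjoint (hamiltonian V n Λ) := by
  rw [IsSelfAdjoint, hamiltonian, tsum_star, ← MultiIndex.bar_involutive.toPerm.tsum_eq
    (f := fun α => V.restrict Λ α • quantizeMonomial n α)]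
  refine tsum_congr fun α => ?_
  rw [star_smul, star_quantizeMonomial]
  exact congr_arg (· • _) (hreal.restrict Λ α)

/-- The generator `s Ĥ_Λ`, with `s = n / 2`, of the finite-volume dynamics. -/
noncomputable def generator (hreal : V.IsReal) (n : ℕ) (Λ : Finset (Site d)) :
    selfAdjoint (QuantumAlg d n) :=
  ((n : ℝ) / 2) • ⟨hamiltonian V n Λ, isSelfAdjoint_hamiltonian hreal Λ⟩

theorem star_propagator_mul_mul (hreal : V.IsReal) (Λ : Finset (Site d)) (t : ℝ)
    (a : QuantumAlg d n) :
    star (propagator V n Λ t) * a * propagator V n Λ t = heisenberg (generator hreal n Λ) t a := by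
  have hprop : propagator V n Λ t =
      star (selfAdjoint.expUnitary (t • generator hreal n Λ) : QuantumAlg d n) := by
    rw [selfAdjoint.expUnitary_coe, NormedSpace.star_exp, propagator, star_smul,
      (t • generator hreal n Λ).2.star_eq]
    simp only [generator, selfAdjoint.val_smul]
    simp only [← Complex.coe_smul, smul_smul]
    congr 2
    simp only [RCLike.star_def, Complex.conj_I]
    push_cast
    ring
  rw [hprop, star_star]
  rfl

theorem isWordSolution_quantumSpin (hn : n ≠ 0) (hV : V.BoundedBy K)
    (hreal : V.IsReal) (Λ : Finset (Site d)) : IsWordSolution (V.restrict Λ)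
      (heisenbergLift (generator hreal n Λ) (quantumSpin n)) := by
  have hgen : HasSum (fun α => V.restrict Λ α • (((n : ℂ) / 2) • quantizeMonomial n α))
      (generator hreal n Λ : QuantumAlg d n) := by
    convert (hasSum_hamiltonian (n := n) hV Λ).const_smul ((n : ℂ) / 2) using 1
    · funext α
      exact smul_comm _ _ _
    · rw [generator, selfAdjoint.val_smul, ← Complex.coe_smul]
      push_cast
      rfl
  refine isWordSolution_heisenbergLift norm_lift_quantumSpin_word_le (fun α B => ?_) hgen
  rw [lift_monomialBracket hn, smul_mul_assoc, mul_smul_comm, ← smul_sub, smul_smul]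

namespace IsQuantumDynamics

variable {α β : ℝ → QuantumAlg d n ≃⋆ₐ[ℂ] QuantumAlg d n}

theorem tendsto_lift (hα : IsQuantumDynamics V n α) (hreal : V.IsReal) (t : ℝ)
    (B : FreeAlgebra ℂ (Letter d)) :
    Tendsto (fun Λ => heisenberg (generator hreal n Λ) t (FreeAlgebra.lift ℂ (quantumSpin n) B))
      atTop (𝓝 (α t (FreeAlgebra.lift ℂ (quantumSpin n) B))) := by
  obtain ⟨Λ₀, h⟩ := exists_lift_mem_localAlg (n := n) B
  simpa only [star_propagator_mul_mul hreal] using hα.limit Λ₀ _ h t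

theorem unique (hn : n ≠ 0) (hreal : V.IsReal) (hα : IsQuantumDynamics V n α)
    (hβ : IsQuantumDynamics V n β) : α = β := by
  have hcont (T : QuantumAlg d n ≃⋆ₐ[ℂ] QuantumAlg d n) : Continuous T :=
    (StarAlgEquiv.isometry T).continuous
  funext t
  refine DFunLike.coe_injective ((hcont (α t)).ext_on (dense_range_lift_quantumSpin hn)
    (hcont (β t)) ?_)
  rintro _ ⟨B, rfl⟩
  exact tendsto_nhds_unique (hα.tendsto_lift hreal t B) (hβ.tendsto_lift hreal t B)

end IsQuantumDynamics

theorem existsUnique_isQuantumDynamics (hn : n ≠ 0) (hV : V.BoundedBy K) (hreal : V.IsReal) :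
    ∃! α, IsQuantumDynamics V n α := by
  have hword := isWordSolution_quantumSpin hn hV hreal
  obtain ⟨α, hzero, hadd, hcont, hlim⟩ := exists_limit_dynamics
    (fun Λ => heisenberg_zero (generator hreal n Λ))
    (fun Λ => heisenberg_add (generator hreal n Λ)) (l := atTop)
    (dense_range_lift_quantumSpin (d := d) hn) (by
      rintro _ ⟨A, rfl⟩ t ε hε
      obtain ⟨F, B, hAB⟩ := exists_isApproxEvolution hV A t hε
      refine ⟨FreeAlgebra.lift ℂ (quantumSpin n) B, ?_⟩
      filter_upwards [eventually_restrict_approximates V F] with Λ hΛ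
      simpa only [heisenbergLift_apply, heisenberg_zero] using hAB _ hΛ (hword Λ)) (by
      rintro _ ⟨A, rfl⟩
      exact ⟨2 * K * wnorm 1 A, fun Λ t u =>
        (hword Λ).norm_sub_le (hV.mono (V.norm_restrict_le Λ)) t u A⟩)
  have hα : IsQuantumDynamics V n α :=
    { zero := hzero
      add := hadd
      continuous := hcont
      limit := fun Λ₀ a _ t => by simpa only [star_propagator_mul_mul hreal] using hlim t a }
  exact ⟨α, hα, fun β hβ => hβ.unique hn hreal hα⟩

end Quantum

/-! ### Normal ordering and the classical limit -/

section ClassicalLimit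

variable {d n : ℕ} {V : Potential d} {K : ℝ}

/-- The noncommutative polynomial obtained by writing each monomial of `A` in normal order. -/
noncomputable def normalOrder : Poly d →ₗ[ℂ] FreeAlgebra ℂ (Letter d) :=
  (MvPolynomial.basisMonomials (Letter d) ℂ).constr ℂ fun α => word (normalWord α)

/-- The classical symbol of a noncommutative polynomial: its letters are made to commute. -/
noncomputable def symbol : FreeAlgebra ℂ (Letter d) →ₐ[ℂ] Poly d :=
  FreeAlgebra.lift ℂ MvPolynomial.X

theorem normalOrder_monomial (α : MultiIndex d) :
    normalOrder (MvPolynomial.monomial α 1) = word (normalWord α) := by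
  have h := (MvPolynomial.basisMonomials (Letter d) ℂ).constr_basis ℂ
    (fun α => word (normalWord α)) α
  rwa [MvPolynomial.coe_basisMonomials] at h

theorem symbol_word (w : List (Letter d)) :
    symbol (word w) = MvPolynomial.monomial (Multiset.toFinsupp (w : Multiset (Letter d))) 1 := by
  induction w with
  | nil => simp
  | cons p w ih =>
    rw [word_cons, map_mul, ih, symbol, FreeAlgebra.lift_ι_apply, MvPolynomial.X,
      MvPolynomial.monomial_mul, one_mul, ← Multiset.cons_coe, ← Multiset.singleton_add, map_add,
      Multiset.toFinsupp_singleton]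

theorem symbol_normalOrder (A : Poly d) : symbol (normalOrder A) = A := by
  have h : symbol.toLinearMap ∘ₗ normalOrder = (LinearMap.id : Poly d →ₗ[ℂ] Poly d) := by
    refine (MvPolynomial.basisMonomials (Letter d) ℂ).ext fun α => ?_
    rw [MvPolynomial.coe_basisMonomials, LinearMap.comp_apply, normalOrder_monomial,
      AlgHom.toLinearMap_apply, symbol_word, coe_normalWord, Finsupp.toMultiset_toFinsupp,
      LinearMap.id_apply]
  exact LinearMap.congr_fun h A

theorem toFun_symbol (B : FreeAlgebra ℂ (Letter d)) :
    (symbol B).toFun = FreeAlgebra.lift ℂ classicalSpin B := by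
  refine DFunLike.congr_fun (?_ : Poly.toFun.comp symbol = FreeAlgebra.lift ℂ classicalSpin) B
  ext1
  funext p
  simp [symbol, Poly.toFun]

theorem quantize_eq (A : Poly d) :
    quantize n A = FreeAlgebra.lift ℂ (quantumSpin n) (normalOrder A) := by
  conv_rhs => rw [A.as_sum]
  rw [quantize, map_sum, map_sum]
  refine Finset.sum_congr rfl fun α _ => ?_
  rw [← mul_one (A.coeff α), ← smul_eq_mul, ← MvPolynomial.smul_monomial, map_smul, map_smul,
    normalOrder_monomial, ← quantizeMonomial_eq, smul_eq_mul, mul_one]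

theorem exists_norm_lift_word_sub_le_of_perm {L : Type*} {w w' : List L} (h : w.Perm w') (c : ℝ) :
    ∃ C, ∀ {𝔅 : Type} [NormedRing 𝔅] [NormOneClass 𝔅] [NormedAlgebra ℂ 𝔅] {s : L → 𝔅} {δ : ℝ},
      (∀ a, ‖s a‖ ≤ c) → (∀ a b, ‖s a * s b - s b * s a‖ ≤ δ) →
        ‖FreeAlgebra.lift ℂ s (word w) - FreeAlgebra.lift ℂ s (word w')‖ ≤ C * δ := by
  induction h with
  | nil => exact ⟨0, fun _ _ => by simp⟩
  | @cons a w w' _ ih =>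
    obtain ⟨C, hC⟩ := ih
    refine ⟨c * C, fun {_ _ _ _ s δ} hs hδ => ?_⟩
    rw [word_cons, word_cons, map_mul, map_mul, FreeAlgebra.lift_ι_apply, ← mul_sub, mul_assoc]
    exact norm_mul_le_of_le (hs a) (hC hs hδ)
  | swap a b w =>
    refine ⟨c ^ w.length, fun {_ _ _ _ s δ} hs hδ => ?_⟩
    simp only [word_cons, map_mul, FreeAlgebra.lift_ι_apply]
    rw [← mul_assoc, ← mul_assoc, ← sub_mul, mul_comm (c ^ _)]
    exact norm_mul_le_of_le (hδ b a) (norm_lift_word_le hs w)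
  | trans _ _ ih₁ ih₂ =>
    obtain ⟨C₁, h₁⟩ := ih₁
    obtain ⟨C₂, h₂⟩ := ih₂
    refine ⟨C₁ + C₂, fun {_ _ _ _ s δ} hs hδ => ?_⟩
    rw [add_mul, ← sub_add_sub_cancel]
    exact norm_add_le_of_le (h₁ hs hδ) (h₂ hs hδ)

theorem norm_quantumSpin_commutator_le (hn : n ≠ 0) (a b : Letter d) :
    ‖quantumSpin n a * quantumSpin n b - quantumSpin n b * quantumSpin n a‖ ≤
      Real.exp (1 / 2) / ((n : ℝ) / 2) := by
  have hbracket : ‖FreeAlgebra.lift ℂ (quantumSpin n) (spinBracket a b)‖ ≤ Real.exp (1 / 2) :=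
    calc _ ≤ 1 * wnorm (1 / 2) (spinBracket a b) :=
          norm_le_mul_wnorm (f := (FreeAlgebra.lift ℂ (quantumSpin n)).toLinearMap)
            (fun w => (norm_lift_quantumSpin_word_le w).trans_eq (one_mul _).symm) _
      _ ≤ 1 * (1 * Real.exp (1 / 2)) := by
          gcongr
          refine (wnorm_spinBracket_le _ a b).trans ?_
          gcongr
          split_ifs <;> norm_num
      _ = _ := by ring
  rw [quantumSpin_commutator hn, norm_smul, norm_inv, norm_mul, Complex.norm_I, one_mul, norm_div,
    Complex.norm_natCast, Complex.norm_ofNat, inv_mul_eq_div]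
  gcongr

theorem exists_norm_lift_sub_quantize_symbol_le (B : FreeAlgebra ℂ (Letter d)) :
    ∃ C : ℝ, ∀ n : ℕ, n ≠ 0 →
      ‖FreeAlgebra.lift ℂ (quantumSpin n) B - quantize n (symbol B)‖ ≤ C / ((n : ℝ) / 2) := by
  have hperm (w : List (Letter d)) :
      w.Perm (normalWord (Multiset.toFinsupp (w : Multiset (Letter d)))) := by
    rw [← Multiset.coe_eq_coe, coe_normalWord, Multiset.toFinsupp_toMultiset]
  choose C hC using fun w => exists_norm_lift_word_sub_le_of_perm (hperm w) (Real.exp (1 / 2))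
  set b := (wordBasis (Letter d)).repr B
  refine ⟨∑ w ∈ b.support, ‖b w‖ * (C w * Real.exp (1 / 2)), fun n hn => ?_⟩
  have hexpand : FreeAlgebra.lift ℂ (quantumSpin n) B - quantize n (symbol B) =
      ∑ w ∈ b.support, b w • (FreeAlgebra.lift ℂ (quantumSpin n) (word w) -
        FreeAlgebra.lift ℂ (quantumSpin n)
          (word (normalWord (Multiset.toFinsupp (w : Multiset (Letter d)))))) := by
    conv_lhs => rw [← sum_repr_smul_word B]
    simp only [quantize_eq, map_sum, map_smul, symbol_word, normalOrder_monomial, smul_sub,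
      Finset.sum_sub_distrib, b]
  rw [hexpand, Finset.sum_div]
  refine norm_sum_le_of_le _ fun w _ => ?_
  rw [norm_smul, mul_div_assoc, mul_div_assoc]
  gcongr
  exact hC w norm_quantumSpin_le (norm_quantumSpin_commutator_le hn)

theorem IsClassicalDynamics.norm_lift_sub_le
    {α : ℝ → ClassicalAlg d ≃⋆ₐ[ℂ] ClassicalAlg d} (hα : IsClassicalDynamics V α)
    (hV : V.BoundedBy K) {F : Finset (MultiIndex d)} {ε t : ℝ} {A B : FreeAlgebra ℂ (Letter d)}
    (hε : 0 ≤ ε) (h : IsApproxEvolution V F ε t A B) :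
    ‖α t (FreeAlgebra.lift ℂ classicalSpin A) - FreeAlgebra.lift ℂ classicalSpin B‖ ≤ ε := by
  obtain ⟨φ, hφ, hαφ⟩ := hα.flow
  refine (ContinuousMap.norm_le _ hε).2 fun M => ?_
  rw [ContinuousMap.sub_apply, hαφ, lift_classicalSpin_apply, lift_classicalSpin_apply]
  exact hφ.norm_evalAt_sub_le hV (.refl V F) h M

theorem IsQuantumDynamics.norm_lift_sub_le {α : ℝ → QuantumAlg d n ≃⋆ₐ[ℂ] QuantumAlg d n}
    (hα : IsQuantumDynamics V n α) (hn : n ≠ 0) (hV : V.BoundedBy K) (hreal : V.IsReal)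
    {F : Finset (MultiIndex d)} {ε t : ℝ} {A B : FreeAlgebra ℂ (Letter d)}
    (h : IsApproxEvolution V F ε t A B) :
    ‖α t (FreeAlgebra.lift ℂ (quantumSpin n) A) - FreeAlgebra.lift ℂ (quantumSpin n) B‖ ≤ ε := by
  refine le_of_tendsto ((hα.tendsto_lift hreal t A).sub_const _).norm ?_
  filter_upwards [eventually_restrict_approximates V F] with Λ hΛ
  simpa only [heisenbergLift_apply, heisenberg_zero] using
    h _ hΛ (isWordSolution_quantumSpin hn hV hreal Λ)

end ClassicalLimit

end SpinSystem

open SpinSystem in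
theorem mainTheorem2_general {d : ℕ} {V : Potential d} {K : ℝ} (hreal : V.IsReal)
    (hV : V.BoundedBy K) :
    (∃! α, IsClassicalDynamics V α) ∧
    (∀ n : ℕ, 1 ≤ n → ∃! αq, IsQuantumDynamics V n αq) ∧
    ∀ (α : ℝ → ClassicalAlg d ≃⋆ₐ[ℂ] ClassicalAlg d)
      (αq : ∀ n : ℕ, ℝ → QuantumAlg d n ≃⋆ₐ[ℂ] QuantumAlg d n),
      IsClassicalDynamics V α →
      (∀ n : ℕ, 1 ≤ n → IsQuantumDynamics V n (αq n)) →
      ∀ (A : Poly d) (ε : ℝ), 0 < ε →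
        ∃ At : ℝ → Poly d,
          (∀ t : ℝ, ‖α t (Poly.toFun A) - Poly.toFun (At t)‖ ≤ ε) ∧
          ∀ t : ℝ, ∃ C : ℝ, ∀ n : ℕ, 1 ≤ n →
            ‖αq n t (quantize n A) - quantize n (At t)‖
              ≤ ε + C / ((n : ℝ) / 2) := by
  refine ⟨existsUnique_isClassicalDynamics hV hreal,
    fun n hn => existsUnique_isQuantumDynamics (Nat.one_le_iff_ne_zero.1 hn) hV hreal,
    fun α αq hα hαq A ε hε => ?_⟩
  choose F B hAB using fun t => exists_isApproxEvolution hV (normalOrder A) t hε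
  refine ⟨fun t => symbol (B t), fun t => ?_, fun t => ?_⟩
  · have hclassical := hα.norm_lift_sub_le hV hε.le (hAB t)
    rwa [← toFun_symbol, ← toFun_symbol, symbol_normalOrder] at hclassical
  · obtain ⟨C, hC⟩ := exists_norm_lift_sub_quantize_symbol_le (B t)
    refine ⟨C, fun n hn => ?_⟩
    have hn0 := Nat.one_le_iff_ne_zero.1 hn
    have hquantum := (hαq n hn).norm_lift_sub_le hn0 hV hreal (hAB t)
    rw [← quantize_eq] at hquantum
    rw [← sub_add_sub_cancel]
    exact norm_add_le_of_le hquantum (hC n hn0)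

theorem mainTheorem2 {d : ℕ} (V : SpinSystem.Potential d) (hreal : V.IsReal)
    (hnorm : V.norm < ⊤) :
    (∃! α, SpinSystem.IsClassicalDynamics V α) ∧
    (∀ n : ℕ, 1 ≤ n → ∃! αq, SpinSystem.IsQuantumDynamics V n αq) ∧
    ∀ (α : ℝ → SpinSystem.ClassicalAlg d ≃⋆ₐ[ℂ] SpinSystem.ClassicalAlg d)
      (αq : ∀ n : ℕ, ℝ → SpinSystem.QuantumAlg d n ≃⋆ₐ[ℂ] SpinSystem.QuantumAlg d n),
      SpinSystem.IsClassicalDynamics V α →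
      (∀ n : ℕ, 1 ≤ n → SpinSystem.IsQuantumDynamics V n (αq n)) →
      ∀ (A : SpinSystem.Poly d) (ε : ℝ), 0 < ε →
        ∃ At : ℝ → SpinSystem.Poly d,
          (∀ t : ℝ, ‖α t (SpinSystem.Poly.toFun A) - SpinSystem.Poly.toFun (At t)‖ ≤ ε) ∧
          ∀ t : ℝ, ∃ C : ℝ, ∀ n : ℕ, 1 ≤ n →
            ‖αq n t (SpinSystem.quantize n A) - SpinSystem.quantize n (At t)‖
              ≤ ε + C / ((n : ℝ) / 2) :=
  mainTheorem2_general hreal (SpinSystem.Potential.boundedBy_of_norm_lt_top hnorm)
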